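/- **Theorem 8.1.** Let $P=(P,\le)$ be a partial order, and let $\kappa=\max(|\operatorname{trcl}(P)|,\aleph_1)$, where $\operatorname{trcl}(P)$ is the transitive closure of (the underlying set of) $P$. For an infinite cardinal $\chi$ let $\mathcal H_\chi$ be the set of all sets $x$ with $|\operatorname{trcl}(x)|<\chi$, and let $\mathcal M_\chi$ be the set of all elementary submodels $M$ of $(\mathcal H_\chi,\in)$ such that $|M|=\aleph_1$ and $[M]^{\aleph_0}\cap M$ is cofinal in $([M]^{\aleph_0},\subseteq)$; here $[X]^\lambda$ is the set of subsets of $X$ of cardinality $\lambda$. For $Q\subseteq P$ write $Q\le_\sigma P$ if for every $p\in P$ the set $\{q\in Q:q\le p\}$ has a countable cofinal subset and the set $\{q\in Q:q\ge p\}$ has a countable coinitial subset. Let $\operatorname{SEP}(P)$ be the statement: for all sufficiently large regular cardinals $\chi$, the set $\{M\in\mathcal M_\chi: P\cap M\le_\sigma P\}$ is cofinal in $[\mathcal H_\chi]^{\aleph_1}$, that is, every $X\in[\mathcal H_\chi]^{\aleph_1}$ is included in some member of it. For a regular cardinal $\chi>\kappa$ let $$\mathcal M(P,\chi)=\{M\in\mathcal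 M_\chi:(P,\le)\in M\text{ and }P\cap M\le_\sigma P\}.$$ A set $\mathcal C\subseteq[\mathcal H_\chi]^{\aleph_1}$ is club if it is cofinal in $[\mathcal H_\chi]^{\aleph_1}$ with respect to $\subseteq$ and closed under unions of nonempty $\subseteq$-chains of at most $\aleph_1$ members, and a subset of $[\mathcal H_\chi]^{\aleph_1}$ is stationary if it meets every club. Then the following are equivalent: 1. $\operatorname{SEP}(P)$. 2. There is a regular cardinal $\chi>\kappa$ such that $\mathcal M(P,\chi)$ is stationary in $[\mathcal H_\chi]^{\aleph_1}$. 3. For every regular cardinal $\chi>\kappa$, $\mathcal M(P,\chi)$ is stationary in $[\mathcal H_\chi]^{\aleph_1}$. 4. There is a regular cardinal $\chi>2^\kappa$ such that $\mathcal M(P,\chi)$ is non-empty. 5. For every regular cardinal $\chi>2^\kappa$, $\mathcal M(P,\chi)$ is non-empty. -/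

import Mathlib

open Cardinal

universe u

namespace SepPrinciple

/-! ### Transitive closure and the sets `H_χ` -/

/-- The transitive closure of `x`: `x ∪ ⋃x ∪ ⋃⋃x ∪ ⋯`, the least transitive set including `x`. -/
noncomputable def trcl (x : ZFSet.{u}) : ZFSet.{u} :=
  ZFSet.iUnion fun n : ℕ => ZFSet.sUnion^[n] x

theorem subset_trcl (x : ZFSet.{u}) : x ⊆ trcl x := by
  intro y hy
  exact ZFSet.mem_iUnion.2 ⟨0, hy⟩

theorem isTransitive_trcl (x : ZFSet.{u}) : (trcl x).IsTransitive := by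
  intro y hy z hz
  obtain ⟨n, hn⟩ := ZFSet.mem_iUnion.1 hy
  refine ZFSet.mem_iUnion.2 ⟨n + 1, ?_⟩
  rw [Function.iterate_succ_apply']
  exact ZFSet.mem_sUnion.2 ⟨y, hn, hz⟩

theorem trcl_subset {x t : ZFSet.{u}} (hx : x ⊆ t) (ht : t.IsTransitive) : trcl x ⊆ t := by
  intro y hy
  obtain ⟨n, hn⟩ := ZFSet.mem_iUnion.1 hy
  induction n generalizing y with
  | zero => exact hx hn
  | succ n ih =>
    rw [Function.iterate_succ_apply'] at hn
    obtain ⟨z, hz, hyz⟩ := ZFSet.mem_sUnion.1 hn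
    exact ht z (ih (ZFSet.mem_iUnion.2 ⟨n, hz⟩) hz) hyz

/-- `H_χ`, the collection of all sets whose transitive closure has cardinality less than `χ`. -/
def H (χ : Cardinal.{u}) : Set ZFSet.{u} :=
  {x | (trcl x).card < χ}

/-! ### The first-order structure `(H_χ, ∈)` and its elementary submodels -/

/-- The only non-logical symbol of the language of set theory: a binary relation symbol. -/
inductive MemRel : ℕ → Type
  | mem : MemRel 2

/-- The first-order language of set theory. -/
def langSet : FirstOrder.Language.{0, 0} :=
  ⟨fun _ => Empty, MemRel⟩

/-- The membership symbol. -/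
def memSymbol : langSet.Relations 2 :=
  MemRel.mem

/-- Every collection of sets is a structure for the language of set theory, with the membership
relation. -/
instance memStructure (X : Set ZFSet.{u}) : langSet.Structure X where
  funMap := fun f => nomatch f
  RelMap := fun {_} r =>
    match r with
    | MemRel.mem => fun v => ((v 0 : X) : ZFSet.{u}) ∈ ((v 1 : X) : ZFSet.{u})

theorem relMap_memSymbol (X : Set ZFSet.{u}) (v : Fin 2 → X) :
    FirstOrder.Language.Structure.RelMap memSymbol v ↔
      ((v 0 : X) : ZFSet.{u}) ∈ ((v 1 : X) : ZFSet.{u}) :=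
  Iff.rfl

/-- `M ≼ X`, where `M` and `X` carry the membership relation. -/
def IsElementarySubmodel (M X : Set ZFSet.{u}) : Prop :=
  ∃ S : langSet.ElementarySubstructure X, M = Subtype.val '' (S : Set X)

/-! ### `[X]^κ`, cofinal, club and stationary subsets -/

/-- `[X]^κ`, the collection of all subsets of `X` of cardinality exactly `κ`. -/
def subsetsOfCard (X : Set ZFSet.{u}) (κ : Cardinal.{u + 1}) : Set (Set ZFSet.{u}) :=
  {Y | Y ⊆ X ∧ #Y = κ}

/-- Every member of `𝒳` is included in some member of `𝒮`. -/
def CofinalIn (𝒮 𝒳 : Set (Set ZFSet.{u})) : Prop :=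
  ∀ Y ∈ 𝒳, ∃ M ∈ 𝒮, Y ⊆ M

/-- `𝒞` is closed unbounded in `[X]^ℵ₁`: it is a cofinal subset of `[X]^ℵ₁` which is closed under
unions of nonempty chains of at most `ℵ₁` members. -/
def IsClub (X : Set ZFSet.{u}) (𝒞 : Set (Set ZFSet.{u})) : Prop :=
  𝒞 ⊆ subsetsOfCard X ℵ₁ ∧
  CofinalIn 𝒞 (subsetsOfCard X ℵ₁) ∧
  ∀ 𝒟 ⊆ 𝒞, 𝒟.Nonempty → IsChain (· ⊆ ·) 𝒟 → #𝒟 ≤ ℵ₁ → ⋃₀ 𝒟 ∈ 𝒞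

/-- `𝒮` is stationary in `[X]^ℵ₁`: it meets every closed unbounded subset of `[X]^ℵ₁`. -/
def IsStationary (X : Set ZFSet.{u}) (𝒮 : Set (Set ZFSet.{u})) : Prop :=
  𝒮 ⊆ subsetsOfCard X ℵ₁ ∧ ∀ 𝒞, IsClub X 𝒞 → (𝒮 ∩ 𝒞).Nonempty

/-! ### Good elementary submodels -/

/-- `[M]^ℵ₀ ∩ M`: the countably infinite subsets of `M` that are elements of `M`. -/
def countableMembers (M : Set ZFSet.{u}) : Set (Set ZFSet.{u}) :=
  {Y | Y ∈ subsetsOfCard M ℵ₀ ∧ ∃ y ∈ M, (y : Set ZFSet.{u}) = Y}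

/-- `ℳ_χ`: the elementary submodels `M` of `H_χ` of cardinality `ℵ₁` for which `[M]^ℵ₀ ∩ M` is
cofinal in `[M]^ℵ₀`. -/
def goodModels (χ : Cardinal.{u}) : Set (Set ZFSet.{u}) :=
  {M | IsElementarySubmodel M (H χ) ∧ #M = ℵ₁ ∧
    CofinalIn (countableMembers M) (subsetsOfCard M ℵ₀)}

/-! ### Partial orders that are sets -/

/-- A partial order in the universe of sets: an underlying set together with a (reflexive) partial
order relation on it, given as a set of ordered pairs. -/
structure SetPoset : Type (u + 1) where
  /-- the underlying set -/
  carrier : ZFSet.{u}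
  /-- the order relation -/
  rel : ZFSet.{u}
  rel_subset : rel ⊆ ZFSet.prod carrier carrier
  refl : ∀ x ∈ carrier, ZFSet.pair x x ∈ rel
  antisymm : ∀ x y, ZFSet.pair x y ∈ rel → ZFSet.pair y x ∈ rel → x = y
  trans : ∀ x y z, ZFSet.pair x y ∈ rel → ZFSet.pair y z ∈ rel → ZFSet.pair x z ∈ rel

namespace SetPoset

variable (P : SetPoset.{u})

/-- The partial order as a single set, the ordered pair of the underlying set and the relation. -/
def code : ZFSet.{u} :=
  ZFSet.pair P.carrier P.rel

/-- `p ≤ q` in `P`. -/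
def Le (p q : ZFSet.{u}) : Prop :=
  ZFSet.pair p q ∈ P.rel

/-- `Q ≤_σ P` for a suborder `Q` of `P`, given by its underlying set: for every `p ∈ P`, the set
`{q ∈ Q : q ≤ p}` has a countable cofinal subset and the set `{q ∈ Q : p ≤ q}` has a countable
coinitial subset. -/
def LeSigma (Q : Set ZFSet.{u}) : Prop :=
  Q ⊆ (P.carrier : Set ZFSet.{u}) ∧
  ∀ p ∈ P.carrier,
    (∃ C ⊆ {q ∈ Q | P.Le q p}, C.Countable ∧ ∀ q ∈ Q, P.Le q p → ∃ c ∈ C, P.Le q c) ∧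
    (∃ C ⊆ {q ∈ Q | P.Le p q}, C.Countable ∧ ∀ q ∈ Q, P.Le p q → ∃ c ∈ C, P.Le c q)

/-- `SEP(P)`: for all sufficiently large regular `χ`, the `M ∈ ℳ_χ` with `P ∩ M ≤_σ P` are cofinal
in `[H_χ]^ℵ₁`. -/
def SEP : Prop :=
  ∃ χ₀ : Cardinal.{u}, ∀ χ : Cardinal.{u}, χ.IsRegular → χ₀ ≤ χ →
    CofinalIn {M ∈ goodModels χ | P.LeSigma ((P.carrier : Set ZFSet.{u}) ∩ M)}
      (subsetsOfCard (H χ) ℵ₁)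

/-- `ℳ(P, χ)`: the `M ∈ ℳ_χ` with `P ∈ M` (as a structure) and `P ∩ M ≤_σ P`. -/
def models (χ : Cardinal.{u}) : Set (Set ZFSet.{u}) :=
  {M ∈ goodModels χ | P.code ∈ M ∧ P.LeSigma ((P.carrier : Set ZFSet.{u}) ∩ M)}

/-- `κ = max(|trcl(P)|, ℵ₁)`. -/
noncomputable def kappa : Cardinal.{u} :=
  max (trcl P.carrier).card ℵ₁

end SetPoset

end SepPrinciple

namespace SepPrinciple

open ZFSet Ordinal

/-! The equivalence rests on a reflection property that does not mention χ,
`SetPoset.HasReflection`: each f : D → D admits a set N ⊆ D of size at most ℵ₁, closed under f and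
pairing, including W, covered by its own countable elements, with P ∩ N ≤_σ P. Here P ⊆ D and |W| =
ℵ₁.

Reflection follows from stationarity with D = H_χ, since the sets closed under f form a club
(`exists_hasReflection_of_isStationary`). It also follows from a single model M once χ > 2^κ
(`exists_hasReflection_of_nonempty_models`). Take D of size at most 2^κ, closed under countable
subsets and including trcl(P) and ω₁. A failure of reflection on D is then witnessed inside H_χ, so
by elementarity some failure, perhaps for another D, is witnessed by elements of M; but N = D ∩ M
refutes that one.

Conversely, reflection gives stationarity for every regular χ > κ (`HasReflection.isStationary`).
Countable elementary submodels V d of H_χ are attached to all sets d, increasing along pairing, and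
M is the union of V d over d ∈ N. A suitable f makes P ∩ M = P ∩ N, so ≤_σ passes from N to M.
Covering by countable elements passes from N to M as well, and it makes M a σ-directed union of
members of a prescribed club, hence itself a member. -/

/-! ### Closure properties of H_χ -/

theorem trcl_mono {x y : ZFSet.{u}} (h : x ⊆ y) : trcl x ⊆ trcl y :=
  trcl_subset (fun _ hz => subset_trcl y (h hz)) (isTransitive_trcl y)

theorem trcl_subset_of_mem {x y : ZFSet.{u}} (h : y ∈ x) : trcl y ⊆ trcl x :=
  trcl_subset (isTransitive_trcl x y (subset_trcl x h)) (isTransitive_trcl x)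

theorem mem_H_of_subset_isTransitive {χ : Cardinal.{u}} {x t : ZFSet.{u}} (hx : x ⊆ t)
    (ht : t.IsTransitive) (hc : t.card < χ) : x ∈ H χ :=
  (card_mono (trcl_subset hx ht)).trans_lt hc

theorem mem_H_of_mem {χ : Cardinal.{u}} {x y : ZFSet.{u}} (hx : x ∈ H χ) (hy : y ∈ x) : y ∈ H χ :=
  (card_mono (trcl_subset_of_mem hy)).trans_lt hx

theorem mem_H_of_subset {χ : Cardinal.{u}} {x y : ZFSet.{u}} (hx : x ∈ H χ) (hy : y ⊆ x) :
    y ∈ H χ :=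
  (card_mono (trcl_mono hy)).trans_lt hx

theorem card_lt_of_mem_H {χ : Cardinal.{u}} {x : ZFSet.{u}} (hx : x ∈ H χ) : x.card < χ :=
  (card_mono (subset_trcl x)).trans_lt hx

theorem mem_H_of_forall_mem {χ : Cardinal.{u}} (hχ : χ.IsRegular) {x : ZFSet.{u}}
    (hc : x.card < χ) (hx : ∀ y ∈ x, y ∈ H χ) : x ∈ H χ := by
  let t : ZFSet.{u} := x ∪ ZFSet.iUnion fun y : Shrink.{u} x => trcl ((equivShrink x).symm y).1
  have hmem : ∀ z, z ∈ t ↔ z ∈ x ∨ ∃ y ∈ x, z ∈ trcl y := by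
    intro z
    simp only [t, ZFSet.mem_union, ZFSet.mem_iUnion]
    refine or_congr Iff.rfl ⟨?_, ?_⟩
    · rintro ⟨i, hi⟩
      exact ⟨_, ((equivShrink x).symm i).2, hi⟩
    · rintro ⟨y, hy, hz⟩
      exact ⟨equivShrink x ⟨y, hy⟩, by simpa using hz⟩
  refine mem_H_of_subset_isTransitive (t := t) (fun z hz => (hmem z).2 (Or.inl hz)) ?_ ?_
  · intro y hy z hz
    rcases (hmem y).1 hy with h | ⟨w, hw, h⟩
    · exact (hmem z).2 (Or.inr ⟨y, h, subset_trcl y hz⟩)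
    · exact (hmem z).2 (Or.inr ⟨w, hw, isTransitive_trcl w y h hz⟩)
  · refine card_union_le.trans_lt (add_lt_of_lt hχ.aleph0_le hc ?_)
    have h1 := lift_card_iUnion_le_sum_card.{u, u}
      (f := fun y : Shrink.{u} x => trcl ((equivShrink x).symm y).1)
    rw [Cardinal.lift_id] at h1
    refine h1.trans_lt ?_
    exact Cardinal.sum_lt_of_isRegular hχ hc fun i => hx _ ((equivShrink x).symm i).2

theorem mk_coe (x : ZFSet.{u}) : #(x : Set ZFSet.{u}) = lift.{u + 1} x.card :=
  cardinalMk_coe_sort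

theorem countable_coe_iff {x : ZFSet.{u}} : (x : Set ZFSet.{u}).Countable ↔ x.card ≤ ℵ₀ := by
  rw [← Cardinal.le_aleph0_iff_set_countable, mk_coe, Cardinal.lift_le_aleph0]

theorem mem_H_of_countable {χ : Cardinal.{u}} (hχ : χ.IsRegular) (h : ℵ₀ < χ) {x : ZFSet.{u}}
    (hc : (x : Set ZFSet.{u}).Countable) (hx : ∀ y ∈ x, y ∈ H χ) : x ∈ H χ :=
  mem_H_of_forall_mem hχ ((countable_coe_iff.1 hc).trans_lt h) hx

theorem coe_doubleton (a b : ZFSet.{u}) :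
    (({a, b} : ZFSet.{u}) : Set ZFSet.{u}) = {a, b} := by
  ext; simp

theorem doubleton_mem_of_countable_closed {D : Set ZFSet.{u}}
    (hD : ∀ y : ZFSet.{u}, (y : Set ZFSet.{u}) ⊆ D → (y : Set ZFSet.{u}).Countable → y ∈ D)
    {a b : ZFSet.{u}} (ha : a ∈ D) (hb : b ∈ D) : ({a, b} : ZFSet.{u}) ∈ D := by
  refine hD _ ?_ ?_
  · rw [coe_doubleton]
    rintro z (rfl | rfl) <;> assumption
  · rw [coe_doubleton]
    exact (Set.countable_singleton _).insert _

theorem pair_mem_of_countable_closed {D : Set ZFSet.{u}}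
    (hD : ∀ y : ZFSet.{u}, (y : Set ZFSet.{u}) ⊆ D → (y : Set ZFSet.{u}).Countable → y ∈ D)
    {a b : ZFSet.{u}} (ha : a ∈ D) (hb : b ∈ D) : pair a b ∈ D := by
  have h1 := doubleton_mem_of_countable_closed hD ha ha
  rw [pair_eq_singleton] at h1
  exact doubleton_mem_of_countable_closed hD h1 (doubleton_mem_of_countable_closed hD ha hb)

theorem pair_mem_H {χ : Cardinal.{u}} (hχ : χ.IsRegular) (h : ℵ₀ < χ) {a b : ZFSet.{u}}
    (ha : a ∈ H χ) (hb : b ∈ H χ) : pair a b ∈ H χ :=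
  pair_mem_of_countable_closed (fun _ h1 h2 => mem_H_of_countable hχ h h2 h1) ha hb

theorem exists_coe_eq (A : Set ZFSet.{u}) [Small.{u} A] :
    ∃ z : ZFSet.{u}, (z : Set ZFSet.{u}) = A :=
  ⟨ZFSet.range (Subtype.val : A → ZFSet.{u}), by simp⟩

theorem exists_coe_eq_of_subset (A : Set ZFSet.{u}) (x : ZFSet.{u}) (hA : A ⊆ x) :
    ∃ z : ZFSet.{u}, (z : Set ZFSet.{u}) = A :=
  ⟨x.sep (· ∈ A), by ext z; simp; exact fun h => hA h⟩

theorem toZFSet_mem_H {χ : Cardinal.{u}} {o : Ordinal.{u}} (h : o.card < χ) : o.toZFSet ∈ H χ :=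
  mem_H_of_subset_isTransitive (fun _ h => h) (ZFSet.isOrdinal_toZFSet o).isTransitive
    (by rwa [Ordinal.card_toZFSet])

/-! ### Sets of size ℵ₁ and clubs -/

theorem aleph_one_le_mk_H {χ : Cardinal.{u}} (h : ℵ₁ < χ) : ℵ₁ ≤ #(H χ) := by
  have h1 : ((Ordinal.omega 1 : Ordinal.{u}).toZFSet : Set ZFSet.{u}) ⊆ H χ := fun x hx =>
    mem_H_of_mem (toZFSet_mem_H (by simpa using h)) hx
  have h2 := Cardinal.mk_le_mk_of_subset h1
  rw [mk_coe] at h2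
  simpa using h2

theorem exists_subsetsOfCard {X Y : Set ZFSet.{u}} (hX : ℵ₁ ≤ #X) (hY : Y ⊆ X) (hc : #Y ≤ ℵ₁) :
    ∃ Z ∈ subsetsOfCard X ℵ₁, Y ⊆ Z := by
  obtain ⟨Z, h1, h2⟩ := Cardinal.le_mk_iff_exists_subset.1 hX
  refine ⟨Y ∪ Z, ⟨Set.union_subset hY h1, le_antisymm ?_ ?_⟩, Set.subset_union_left⟩
  · refine (Cardinal.mk_union_le _ _).trans ?_
    rw [h2]
    exact Cardinal.add_le_of_le (Cardinal.aleph0_le_aleph 1) hc le_rfl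
  · rw [← h2]
    exact Cardinal.mk_le_mk_of_subset Set.subset_union_right

theorem mk_sUnion_le_aleph_one {α : Type*} {𝒟 : Set (Set α)} (h : #𝒟 ≤ ℵ₁)
    (h' : ∀ s ∈ 𝒟, #s ≤ ℵ₁) : #(⋃₀ 𝒟) ≤ ℵ₁ := by
  refine (Cardinal.mk_sUnion_le _).trans ?_
  refine (mul_le_mul' h (ciSup_le' fun s : 𝒟 => h' s.1 s.2)).trans ?_
  exact (Cardinal.mul_eq_self (Cardinal.aleph0_le_aleph 1)).le

theorem mk_iUnion_le_aleph_one {α : Type*} {ι : Type} [Countable ι] {f : ι → Set α}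
    (h' : ∀ i, #(f i) ≤ ℵ₁) : #(⋃ i, f i) ≤ ℵ₁ := by
  rw [← Set.sUnion_range]
  refine mk_sUnion_le_aleph_one ?_ (by rintro _ ⟨i, rfl⟩; exact h' i)
  exact (Set.countable_range f).le_aleph0.trans (Cardinal.aleph0_le_aleph 1)

theorem exists_closed_superset {X Y : Set ZFSet.{u}} (hX : ℵ₁ ≤ #X) (hY : Y ⊆ X) (hc : #Y ≤ ℵ₁)
    {ι : Type} [Countable ι] (F : ι → ZFSet.{u} → ZFSet.{u} → ZFSet.{u})
    (hF : ∀ i, ∀ a ∈ X, ∀ b ∈ X, F i a b ∈ X) :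
    ∃ N ∈ subsetsOfCard X ℵ₁, Y ⊆ N ∧ ∀ i, ∀ a ∈ N, ∀ b ∈ N, F i a b ∈ N := by
  obtain ⟨Z, ⟨hZX, hZc⟩, hYZ⟩ := exists_subsetsOfCard hX hY hc
  let step : Set ZFSet.{u} → Set ZFSet.{u} := fun S =>
    S ∪ ⋃ i, (fun p : ZFSet.{u} × ZFSet.{u} => F i p.1 p.2) '' (S ×ˢ S)
  let s : ℕ → Set ZFSet.{u} := fun n => step^[n] Z
  have hs : ∀ n, s (n + 1) = step (s n) := fun n => Function.iterate_succ_apply' _ _ _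
  have hmono : Monotone s := monotone_nat_of_le_succ fun n => by
    rw [hs]; exact Set.subset_union_left
  have hsX : ∀ n, s n ⊆ X := by
    intro n
    induction n with
    | zero => exact hZX
    | succ n ih =>
      rw [hs]
      refine Set.union_subset ih (Set.iUnion_subset fun i => ?_)
      rintro _ ⟨p, hp, rfl⟩
      exact hF i _ (ih hp.1) _ (ih hp.2)
  have hsc : ∀ n, #(s n) ≤ ℵ₁ := by
    intro n
    induction n with
    | zero => exact hZc.le
    | succ n ih =>
      rw [hs]
      refine (Cardinal.mk_union_le _ _).trans
        (Cardinal.add_le_of_le (Cardinal.aleph0_le_aleph 1) ih (mk_iUnion_le_aleph_one fun i => ?_))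
      refine Cardinal.mk_image_le.trans ?_
      rw [Cardinal.mk_setProd]
      exact Cardinal.mul_le_of_le (Cardinal.aleph0_le_aleph 1) ih ih
  refine ⟨⋃ n, s n, ⟨Set.iUnion_subset hsX, le_antisymm (mk_iUnion_le_aleph_one hsc) ?_⟩,
    hYZ.trans (Set.subset_iUnion s 0), ?_⟩
  · rw [← hZc]
    exact Cardinal.mk_le_mk_of_subset (Set.subset_iUnion s 0)
  · intro i a ha b hb
    obtain ⟨m, hm⟩ := Set.mem_iUnion.1 ha
    obtain ⟨n, hn⟩ := Set.mem_iUnion.1 hb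
    refine Set.mem_iUnion.2 ⟨max m n + 1, ?_⟩
    rw [hs]
    exact Or.inr (Set.mem_iUnion.2 ⟨i, (a, b),
      ⟨hmono (le_max_left m n) hm, hmono (le_max_right m n) hn⟩, rfl⟩)

theorem isClub_closed {X Y : Set ZFSet.{u}} (hX : ℵ₁ ≤ #X) (hY : Y ⊆ X) (hc : #Y ≤ ℵ₁)
    {ι : Type} [Countable ι] (F : ι → ZFSet.{u} → ZFSet.{u} → ZFSet.{u})
    (hF : ∀ i, ∀ a ∈ X, ∀ b ∈ X, F i a b ∈ X) :
    IsClub X {N ∈ subsetsOfCard X ℵ₁ | Y ⊆ N ∧ ∀ i, ∀ a ∈ N, ∀ b ∈ N, F i a b ∈ N} := by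
  refine ⟨fun N hN => hN.1, ?_, ?_⟩
  · intro Z hZ
    obtain ⟨N, h1, h2, h3⟩ := exists_closed_superset hX (Set.union_subset hY hZ.1)
      ((Cardinal.mk_union_le _ _).trans
        (Cardinal.add_le_of_le (Cardinal.aleph0_le_aleph 1) hc hZ.2.le)) F hF
    exact ⟨N, ⟨h1, (Set.subset_union_left).trans h2, h3⟩, (Set.subset_union_right).trans h2⟩
  · intro 𝒟 h𝒟 ⟨N, hN⟩ hchain hcard
    refine ⟨⟨Set.sUnion_subset fun S hS => (h𝒟 hS).1.1, le_antisymm ?_ ?_⟩, ?_, ?_⟩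
    · exact mk_sUnion_le_aleph_one hcard fun S hS => (h𝒟 hS).1.2.le
    · rw [← (h𝒟 hN).1.2]
      exact Cardinal.mk_le_mk_of_subset (Set.subset_sUnion_of_mem hN)
    · exact (h𝒟 hN).2.1.trans (Set.subset_sUnion_of_mem hN)
    · rintro i a ⟨S, hS, ha⟩ b ⟨T, hT, hb⟩
      rcases hchain.total hS hT with h | h
      · exact ⟨T, hT, (h𝒟 hT).2.2 i a (h ha) b hb⟩
      · exact ⟨S, hS, (h𝒟 hS).2.2 i a ha b (h hb)⟩

/-- A club is closed under unions of `σ`-directed families with a union of size at most `ℵ₁`. -/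
theorem IsClub.mem_of_sigmaDirected {X : Set ZFSet.{u}} {𝒞 : Set (Set ZFSet.{u})}
    (h𝒞 : IsClub X 𝒞) {𝒟 : Set (Set ZFSet.{u})} (h𝒟 : 𝒟 ⊆ 𝒞)
    (hdir : ∀ 𝒟' ⊆ 𝒟, 𝒟'.Countable → ∃ d ∈ 𝒟, ⋃₀ 𝒟' ⊆ d) (hc : #(⋃₀ 𝒟 : Set ZFSet.{u}) = ℵ₁) :
    ⋃₀ 𝒟 ∈ 𝒞 := by
  classical
  let M : Set ZFSet.{u} := ⋃₀ 𝒟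
  -- Well-order M in type ω₁: proper initial segments are countable, so σ-directedness carries a
  -- recursion that produces a chain with union M.
  obtain ⟨r, hr, hro⟩ := Cardinal.exists_ord_eq M
  have hseg : ∀ x : M, {y : M | r y x}.Countable := by
    intro x
    rw [← Cardinal.le_aleph0_iff_set_countable, ← Order.lt_succ_iff, Cardinal.succ_aleph0, ← hc]
    exact Cardinal.card_typein_lt (r := r) x hro
  -- Upper bounds as a total function; outside the intended families the value is an arbitrary
  -- member of 𝒟.
  have hub : ∀ 𝒟' : Set (Set ZFSet.{u}), ∃ d ∈ 𝒟, 𝒟' ⊆ 𝒟 → 𝒟'.Countable → ⋃₀ 𝒟' ⊆ d := by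
    intro 𝒟'
    by_cases h : 𝒟' ⊆ 𝒟 ∧ 𝒟'.Countable
    · obtain ⟨d, hd, h'⟩ := hdir 𝒟' h.1 h.2
      exact ⟨d, hd, fun _ _ => h'⟩
    · obtain ⟨d, hd, -⟩ := hdir ∅ (Set.empty_subset _) Set.countable_empty
      exact ⟨d, hd, fun h1 h2 => absurd ⟨h1, h2⟩ h⟩
  choose ub hub1 hub2 using hub
  have hpick : ∀ x : M, ∃ d ∈ 𝒟, (x : ZFSet.{u}) ∈ d := fun x => x.2
  choose pick hpick1 hpick2 using hpick
  let d : M → Set ZFSet.{u} := hr.wf.fix fun x ih =>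
    ub (insert (pick x) (Set.range fun y : {y : M | r y x} => ih y.1 y.2))
  have hd : ∀ x, d x = ub (insert (pick x) (Set.range fun y : {y : M | r y x} => d y.1)) :=
    fun x => hr.wf.fix_eq _ x
  have hd𝒟 : ∀ x, d x ∈ 𝒟 := fun x => by rw [hd]; exact hub1 _
  have hsub : ∀ x, ⋃₀ (insert (pick x) (Set.range fun y : {y : M | r y x} => d y.1)) ⊆ d x := by
    intro x
    conv_rhs => rw [hd]
    refine hub2 _ (Set.insert_subset (hpick1 x) ?_) ?_
    · rintro _ ⟨y, rfl⟩
      exact hd𝒟 _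
    · have := (hseg x).to_subtype
      exact (Set.countable_range _).insert _
  have hlt : ∀ x y, r y x → d y ⊆ d x := fun x y h =>
    (Set.subset_sUnion_of_mem (Or.inr ⟨⟨y, h⟩, rfl⟩)).trans (hsub x)
  have hmem : ∀ x : M, (x : ZFSet.{u}) ∈ d x := fun x =>
    hsub x ⟨pick x, Or.inl rfl, hpick2 x⟩
  have hM : M = ⋃₀ Set.range d := by
    apply Set.Subset.antisymm
    · intro x hx
      exact ⟨_, ⟨⟨x, hx⟩, rfl⟩, hmem ⟨x, hx⟩⟩
    · rintro x ⟨_, ⟨y, rfl⟩, hx⟩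
      exact ⟨_, hd𝒟 y, hx⟩
  change M ∈ 𝒞
  rw [hM]
  have hne : Nonempty M := by
    rw [← Cardinal.mk_ne_zero_iff, hc]
    exact (Cardinal.aleph_pos 1).ne'
  refine h𝒞.2.2 _ ?_ (Set.range_nonempty d) ?_ ?_
  · rintro _ ⟨y, rfl⟩
    exact h𝒟 (hd𝒟 y)
  · rintro _ ⟨x, rfl⟩ _ ⟨y, rfl⟩ _
    rcases trichotomous_of r x y with h | h | h
    · exact Or.inl (hlt _ _ h)
    · exact Or.inl (by rw [h])
    · exact Or.inr (hlt _ _ h)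
  · exact Cardinal.mk_range_le.trans hc.le

/-! ### Elementary submodels, directed unions and countable hulls -/

theorem IsElementarySubmodel.subset {M X : Set ZFSet.{u}} (h : IsElementarySubmodel M X) :
    M ⊆ X := by
  obtain ⟨S, rfl⟩ := h
  rintro _ ⟨x, _, rfl⟩
  exact x.2

theorem card_langSet_le : langSet.card ≤ ℵ₀ := by
  have h1 : Countable langSet.Symbols := by
    have : Countable (Σ n, MemRel n) :=
      Function.Injective.countable (f := fun _ => ()) (by
        rintro ⟨_, ⟨⟩⟩ ⟨_, ⟨⟩⟩ _; rfl)
    have : Countable (Σ _ : ℕ, Empty) := inferInstance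
    exact inferInstanceAs (Countable ((Σ _ : ℕ, Empty) ⊕ (Σ n, MemRel n)))
  exact Cardinal.mk_le_aleph0_iff.2 h1

theorem exists_countable_isElementarySubmodel {X A : Set ZFSet.{u}} (hX : ℵ₀ ≤ #X) (hA : A ⊆ X)
    (hc : A.Countable) : ∃ V, IsElementarySubmodel V X ∧ V.Countable ∧ A ⊆ V := by
  obtain ⟨S, h1, h2⟩ := FirstOrder.Language.exists_elementarySubstructure_card_eq langSet
    (Subtype.val ⁻¹' A : Set X) (ℵ₀ : Cardinal.{0}) le_rfl
    (by
      rw [Cardinal.lift_aleph0, Cardinal.lift_le_aleph0]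
      exact (hc.preimage Subtype.val_injective).le_aleph0)
    (by simpa using card_langSet_le) (by simpa using hX)
  refine ⟨_, ⟨S, rfl⟩, ?_, fun x hx => ⟨⟨x, hA hx⟩, h1 hx, rfl⟩⟩
  refine Set.Countable.image ?_ _
  rw [← Cardinal.le_aleph0_iff_set_countable]
  simpa using h2.le

/-- Tarski–Vaught: finitely many parameters lie in one V i by directedness, and V i already contains
a witness. -/
theorem isElementarySubmodel_iUnion {X : Set ZFSet.{u}} {ι : Type*} [Nonempty ι]
    {V : ι → Set ZFSet.{u}} (hV : ∀ i, IsElementarySubmodel (V i) X)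
    (hdir : Directed (· ⊆ ·) V) : IsElementarySubmodel (⋃ i, V i) X := by
  let T : langSet.Substructure X :=
    { carrier := {x | (x : ZFSet.{u}) ∈ ⋃ i, V i}
      fun_mem := fun f => nomatch f }
  have hT : T.IsElementary := by
    refine T.isElementary_of_exists fun n φ x a h => ?_
    have hx : ∀ j, ∃ i, ((x j : X) : ZFSet.{u}) ∈ V i := fun j => Set.mem_iUnion.1 (x j).2
    choose f hf using hx
    obtain ⟨i, hi⟩ := hdir.finite_le f
    obtain ⟨S, hS⟩ := hV i
    have hxS : ∀ j, (x j : X) ∈ S := fun j => by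
      have := hi j (hf j)
      rw [hS] at this
      obtain ⟨y, hy, hyx⟩ := this
      rwa [← Subtype.ext hyx]
    let y : Fin n → S := fun j => ⟨x j, hxS j⟩
    have hdef : (S.subtype ∘ default : Empty → X) = default := Subsingleton.elim _ _
    have h1 : φ.ex.Realize (S.subtype ∘ default) (S.subtype ∘ y) := by
      rw [FirstOrder.Language.BoundedFormula.realize_ex]
      refine ⟨a, ?_⟩
      rw [hdef]
      exact h
    rw [S.subtype.map_boundedFormula, FirstOrder.Language.BoundedFormula.realize_ex] at h1
    obtain ⟨b, hb⟩ := h1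
    rw [← S.subtype.map_boundedFormula, hdef, Fin.comp_snoc] at hb
    have hbV : ((b : X) : ZFSet.{u}) ∈ V i := by
      rw [hS]
      exact ⟨b, b.2, rfl⟩
    exact ⟨⟨b, Set.mem_iUnion.2 ⟨i, hbV⟩⟩, hb⟩
  refine ⟨⟨T, hT⟩, ?_⟩
  ext x
  constructor
  · intro hx
    obtain ⟨i, hi⟩ := Set.mem_iUnion.1 hx
    exact ⟨⟨x, (hV i).subset hi⟩, hx, rfl⟩
  · rintro ⟨y, hy, rfl⟩
    exact hy

theorem rank_lt_rank_pair_left (a b : ZFSet.{u}) : rank a < rank (pair a b) :=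
  (rank_lt_of_mem (y := a) (x := {a}) (by simp)).trans
    (rank_lt_of_mem (by simp [pair]))

theorem rank_lt_rank_pair_right (a b : ZFSet.{u}) : rank b < rank (pair a b) :=
  (rank_lt_of_mem (y := b) (x := {a, b}) (by simp)).trans
    (rank_lt_of_mem (by simp [pair]))

/-- The recursion is on rank rather than membership because a and b are not elements of `pair a b`,
only of smaller rank. The guard `rank y < rank d` makes the recursive call total. -/
theorem exists_rank_rec (Φ : ZFSet.{u} → (ZFSet.{u} → Set ZFSet.{u}) → Set ZFSet.{u}) :
    ∃ V : ZFSet.{u} → Set ZFSet.{u},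
      ∀ d, V d = Φ d fun y => {x | rank y < rank d ∧ x ∈ V y} := by
  have hwf : WellFounded fun y d : ZFSet.{u} => rank y < rank d := InvImage.wf rank wellFounded_lt
  refine ⟨hwf.fix fun d ih => Φ d fun y => {x | ∃ h : rank y < rank d, x ∈ ih y h}, fun d => ?_⟩
  rw [hwf.fix_eq]
  simp only [exists_prop]

/-- Countable elementary submodels `V d` of `H_χ`, indexed by sets `d` and increasing along pairing,
such that every countable `d` gives rise to an element `⋃_{b ∈ d} V b` of `V d`. -/
theorem exists_hulls {χ : Cardinal.{u}} (hχ : χ.IsRegular) (h1 : ℵ₁ < χ)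
    (G : ZFSet.{u} → Set ZFSet.{u}) (hG : ∀ d, G d ⊆ H χ) (hGc : ∀ d, (G d).Countable)
    (E : ZFSet.{u} → ZFSet.{u} → ZFSet.{u}) (hE : ∀ a, ∀ h ∈ H χ, E a h ∈ H χ) :
    ∃ V : ZFSet.{u} → Set ZFSet.{u}, (∀ d, IsElementarySubmodel (V d) (H χ)) ∧
      (∀ d, (V d).Countable) ∧ (∀ d, G d ⊆ V d) ∧
      (∀ a b, V a ⊆ V (pair a b)) ∧ (∀ a b, V b ⊆ V (pair a b)) ∧
      (∀ a b, ∀ h ∈ V b, E a h ∈ V (pair a b)) ∧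
      ∀ d : ZFSet.{u}, (d : Set ZFSet.{u}).Countable →
        ∃ z ∈ V d, (z : Set ZFSet.{u}) = ⋃ b ∈ (d : Set ZFSet.{u}), V b := by
  have h0 : ℵ₀ < χ := aleph0_lt_aleph_one.trans h1
  have hHinf : ℵ₀ ≤ #(H χ) := (Cardinal.aleph0_le_aleph 1).trans (aleph_one_le_mk_H h1)
  have hull : ∀ A : Set ZFSet.{u}, ∃ V, IsElementarySubmodel V (H χ) ∧ V.Countable ∧
      (A ⊆ H χ → A.Countable → A ⊆ V) := by
    intro A
    by_cases hA : A ⊆ H χ ∧ A.Countable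
    · obtain ⟨V, h2, h3, h4⟩ := exists_countable_isElementarySubmodel hHinf hA.1 hA.2
      exact ⟨V, h2, h3, fun _ _ => h4⟩
    · obtain ⟨V, h2, h3, -⟩ := exists_countable_isElementarySubmodel hHinf
        (Set.empty_subset _) Set.countable_empty
      exact ⟨V, h2, h3, fun h h' => absurd ⟨h, h'⟩ hA⟩
  choose hull hull1 hull2 hull3 using hull
  -- What V d must contain: the prescribed G d; if d is a pair, the earlier hulls and E-values of
  -- its components; if d is countable, the union of the hulls of its elements as a single set.
  let seed : ZFSet.{u} → (ZFSet.{u} → Set ZFSet.{u}) → Set ZFSet.{u} := fun d U =>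
    G d ∪ (⋃ p ∈ {p : ZFSet.{u} × ZFSet.{u} | d = pair p.1 p.2},
      (U p.1 ∪ U p.2 ∪ E p.1 '' U p.2)) ∪
    {z | (d : Set ZFSet.{u}).Countable ∧ (z : Set ZFSet.{u}) = ⋃ b ∈ (d : Set ZFSet.{u}), U b}
  obtain ⟨V, hV⟩ := exists_rank_rec fun d U => hull (seed d U)
  let U : ZFSet.{u} → ZFSet.{u} → Set ZFSet.{u} := fun d y => {x | rank y < rank d ∧ x ∈ V y}
  have hUV : ∀ d y, U d y ⊆ V y := fun d y x hx => hx.2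
  have hU : ∀ d y, rank y < rank d → U d y = V y := fun d y h => by
    ext x; exact ⟨fun hx => hx.2, fun hx => ⟨h, hx⟩⟩
  have hVe : ∀ d, IsElementarySubmodel (V d) (H χ) := fun d => by rw [hV]; exact hull1 _
  have hVc : ∀ d, (V d).Countable := fun d => by rw [hV]; exact hull2 _
  have hVs : ∀ d, seed d (U d) ⊆ V d := by
    intro d
    conv_rhs => rw [hV]
    refine hull3 _ ?_ ?_
    · refine Set.union_subset (Set.union_subset (hG d) ?_) ?_
      · refine Set.iUnion₂_subset fun p _ => Set.union_subset (Set.union_subset ?_ ?_) ?_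
        · exact (hUV _ _).trans (hVe _).subset
        · exact (hUV _ _).trans (hVe _).subset
        · rintro _ ⟨x, hx, rfl⟩
          exact hE _ _ ((hVe _).subset (hUV _ _ hx))
      · rintro z ⟨hd, hz⟩
        refine mem_H_of_countable hχ h0 ?_ ?_
        · rw [hz]
          exact hd.biUnion fun b _ => (hVc b).mono (hUV _ _)
        · intro y hy
          have hy' : y ∈ (z : Set ZFSet.{u}) := hy
          rw [hz] at hy'
          obtain ⟨b, _, hb⟩ := Set.mem_iUnion₂.1 hy'
          exact (hVe _).subset (hUV _ _ hb)
    -- Countability of the seed: d is a pair in at most one way, and at most one set has the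
    -- required extension.
    · refine ((hGc d).union (Set.Countable.biUnion (Set.Subsingleton.countable ?_) ?_)).union
        (Set.Subsingleton.countable ?_)
      · rintro ⟨a, b⟩ hp ⟨a', b'⟩ hp'
        obtain ⟨rfl, rfl⟩ := pair_injective ((Eq.symm hp).trans hp')
        rfl
      · exact fun p _ => (((hVc _).mono (hUV _ _)).union ((hVc _).mono (hUV _ _))).union
          (((hVc _).mono (hUV _ _)).image _)
      · rintro z ⟨_, hz⟩ z' ⟨_, hz'⟩
        exact SetLike.coe_injective (hz.trans hz'.symm)
  have hpair : ∀ a b, V a ∪ V b ∪ E a '' V b ⊆ V (pair a b) := by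
    intro a b x hx
    refine hVs _ (Or.inl (Or.inr (Set.mem_iUnion₂.2 ⟨(a, b), rfl, ?_⟩)))
    simpa only [hU _ _ (rank_lt_rank_pair_left a b), hU _ _ (rank_lt_rank_pair_right a b)] using hx
  refine ⟨V, hVe, hVc, fun d x hx => hVs d (Or.inl (Or.inl hx)),
    fun a b x hx => hpair a b (Or.inl (Or.inl hx)), fun a b x hx => hpair a b (Or.inl (Or.inr hx)),
    fun a b x hx => hpair a b (Or.inr ⟨x, hx, rfl⟩), fun d hd => ?_⟩
  have := (hd.biUnion fun b _ => hVc b).to_subtype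
  obtain ⟨z, hz⟩ := exists_coe_eq (⋃ b ∈ (d : Set ZFSet.{u}), V b)
  refine ⟨z, hVs d (Or.inr ⟨hd, hz.trans ?_⟩), hz⟩
  exact Set.iUnion₂_congr fun b hb => (hU d b (rank_lt_of_mem hb)).symm

/-! ### The reflection property, and P as an element of H_χ -/

namespace SetPoset

variable (P : SetPoset.{u})

/-- Every function on `D` admits a closed set `N` of size `ℵ₁` including `W` which is covered by its
countable elements and for which `P ∩ N ≤_σ P`. -/
def HasReflection (D W : Set ZFSet.{u}) : Prop :=
  ∀ f : ZFSet.{u} → ZFSet.{u}, (∀ a ∈ D, f a ∈ D) →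
    ∃ N ⊆ D, #N ≤ ℵ₁ ∧ W ⊆ N ∧ (∀ a ∈ N, ∀ b ∈ N, pair a b ∈ N) ∧ (∀ a ∈ N, f a ∈ N) ∧
      (∀ Y ⊆ N, Y.Countable → ∃ y ∈ N, Y ⊆ (y : Set ZFSet.{u}) ∧ (y : Set ZFSet.{u}) ⊆ N ∧
        (y : Set ZFSet.{u}).Countable) ∧
      P.LeSigma ((P.carrier : Set ZFSet.{u}) ∩ N)

variable {P}

theorem aleph_one_lt_of_kappa_lt {χ : Cardinal.{u}} (h : P.kappa < χ) : ℵ₁ < χ :=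
  (le_max_right _ _).trans_lt h

theorem carrier_mem_H {χ : Cardinal.{u}} (h : P.kappa < χ) : P.carrier ∈ H χ :=
  (le_max_left _ _).trans_lt h

/-- `kappa` only bounds trcl of the underlying set; the relation has at most |P|² elements, each a
pair from H_χ. -/
theorem rel_mem_H {χ : Cardinal.{u}} (hχ : χ.IsRegular) (h : P.kappa < χ) : P.rel ∈ H χ := by
  have hc := carrier_mem_H h
  have h0 : ℵ₀ < χ := aleph0_lt_aleph_one.trans (aleph_one_lt_of_kappa_lt h)
  refine mem_H_of_forall_mem hχ ?_ fun y hy => ?_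
  · have h1 : (P.rel : Set ZFSet.{u}) ⊆ (fun p : ZFSet.{u} × ZFSet.{u} => pair p.1 p.2) ''
        ((P.carrier : Set ZFSet.{u}) ×ˢ (P.carrier : Set ZFSet.{u})) := by
      intro y hy
      obtain ⟨a, ha, b, hb, rfl⟩ := mem_prod.1 (P.rel_subset hy)
      exact ⟨(a, b), ⟨ha, hb⟩, rfl⟩
    have h2 := (Cardinal.mk_le_mk_of_subset h1).trans Cardinal.mk_image_le
    rw [Cardinal.mk_setProd, mk_coe, mk_coe, ← Cardinal.lift_mul, Cardinal.lift_le] at h2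
    exact h2.trans_lt (Cardinal.mul_lt_of_lt hχ.aleph0_le (card_lt_of_mem_H hc)
      (card_lt_of_mem_H hc))
  · obtain ⟨a, ha, b, hb, rfl⟩ := mem_prod.1 (P.rel_subset hy)
    exact pair_mem_H hχ h0 (mem_H_of_mem hc ha) (mem_H_of_mem hc hb)

theorem code_mem_H {χ : Cardinal.{u}} (hχ : χ.IsRegular) (h : P.kappa < χ) : P.code ∈ H χ :=
  pair_mem_H hχ (aleph0_lt_aleph_one.trans (aleph_one_lt_of_kappa_lt h)) (carrier_mem_H h)
    (rel_mem_H hχ h)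

theorem models_subset (χ : Cardinal.{u}) : P.models χ ⊆ subsetsOfCard (H χ) ℵ₁ :=
  fun _ hM => ⟨hM.1.1.subset, hM.1.2.1⟩

end SetPoset

/-! ### From reflection to stationarity -/

/-- A club gives an assignment of members of the club to sets, increasing along membership in
countable sets. -/
theorem IsClub.exists_assignment {X : Set ZFSet.{u}} (hX : ℵ₁ ≤ #X) {𝒞 : Set (Set ZFSet.{u})}
    (h𝒞 : IsClub X 𝒞) :
    ∃ C : ZFSet.{u} → Set ZFSet.{u}, (∀ s, C s ∈ 𝒞) ∧
      ∀ s : ZFSet.{u}, (s : Set ZFSet.{u}).Countable → (s : Set ZFSet.{u}) ⊆ X →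
        (s : Set ZFSet.{u}) ⊆ C s ∧ ∀ t ∈ s, C t ⊆ C s := by
  have hg : ∀ Y : Set ZFSet.{u}, ∃ N ∈ 𝒞, Y ⊆ X → #Y ≤ ℵ₁ → Y ⊆ N := by
    intro Y
    by_cases h : Y ⊆ X ∧ #Y ≤ ℵ₁
    · obtain ⟨Z, hZ, hYZ⟩ := exists_subsetsOfCard hX h.1 h.2
      obtain ⟨N, hN, hZN⟩ := h𝒞.2.1 Z hZ
      exact ⟨N, hN, fun _ _ => hYZ.trans hZN⟩
    · obtain ⟨Z, hZ, -⟩ := exists_subsetsOfCard hX (Set.empty_subset _) (by simp)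
      obtain ⟨N, hN, -⟩ := h𝒞.2.1 Z hZ
      exact ⟨N, hN, fun h1 h2 => absurd ⟨h1, h2⟩ h⟩
  choose g hg1 hg2 using hg
  -- C d is a member of the club chosen to include d and all C t with t ∈ d, whenever d is a
  -- countable subset of X.
  obtain ⟨C, hC⟩ := exists_rank_rec fun d U => g (d ∪ ⋃ t ∈ (d : Set ZFSet.{u}), U t)
  have hC𝒞 : ∀ s, C s ∈ 𝒞 := fun s => by rw [hC]; exact hg1 _
  refine ⟨C, hC𝒞, fun s hs hsX => ?_⟩
  have hU : (⋃ t ∈ (s : Set ZFSet.{u}), {x | rank t < rank s ∧ x ∈ C t}) =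
      ⋃ t ∈ (s : Set ZFSet.{u}), C t :=
    Set.iUnion₂_congr fun t ht => by
      ext x; exact ⟨fun hx => hx.2, fun hx => ⟨rank_lt_of_mem ht, hx⟩⟩
  have hsub : (s : Set ZFSet.{u}) ∪ ⋃ t ∈ (s : Set ZFSet.{u}), C t ⊆ C s := by
    conv_rhs => rw [hC, hU]
    refine hg2 _ (Set.union_subset hsX (Set.iUnion₂_subset fun t _ => (h𝒞.1 (hC𝒞 t)).1)) ?_
    refine (Cardinal.mk_union_le _ _).trans (Cardinal.add_le_of_le (Cardinal.aleph0_le_aleph 1)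
      (hs.le_aleph0.trans (Cardinal.aleph0_le_aleph 1)) ?_)
    rw [← Set.sUnion_image]
    refine mk_sUnion_le_aleph_one ((hs.image _).le_aleph0.trans (Cardinal.aleph0_le_aleph 1)) ?_
    rintro _ ⟨t, _, rfl⟩
    exact (h𝒞.1 (hC𝒞 t)).2.le
  exact ⟨Set.subset_union_left.trans hsub, fun t ht =>
    (Set.subset_biUnion_of_mem (u := C) (show t ∈ (s : Set ZFSet.{u}) from ht)).trans
      (Set.subset_union_right.trans hsub)⟩

/-- Lets one index set W enumerate every member of the club, so that N ⊇ W reaches all their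
elements. -/
theorem exists_surjOn {W Y : Set ZFSet.{u}} (h : #Y = #W) (hY : Y.Nonempty) :
    ∃ e : ZFSet.{u} → ZFSet.{u}, (∀ a, e a ∈ Y) ∧ ∀ y ∈ Y, ∃ a ∈ W, e a = y := by
  classical
  obtain ⟨e⟩ := Cardinal.eq.1 h
  obtain ⟨y₀, hy₀⟩ := hY
  refine ⟨fun a => if ha : a ∈ W then e.symm ⟨a, ha⟩ else y₀, fun a => ?_, fun y hy => ?_⟩
  · dsimp only
    split_ifs
    · exact (e.symm _).2
    · exact hy₀
  · exact ⟨e ⟨y, hy⟩, (e ⟨y, hy⟩).2, by simp⟩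

theorem exists_injOn {W X : Set ZFSet.{u}} (h : #W ≤ #X) (hX : X.Nonempty) :
    ∃ e : ZFSet.{u} → ZFSet.{u}, (∀ a, e a ∈ X) ∧ Set.InjOn e W := by
  classical
  obtain ⟨e⟩ := Cardinal.le_def _ _ |>.1 h
  obtain ⟨y₀, hy₀⟩ := hX
  refine ⟨fun a => if ha : a ∈ W then e ⟨a, ha⟩ else y₀, fun a => ?_, fun a ha b hb hab => ?_⟩
  · dsimp only
    split_ifs
    · exact (e _).2
    · exact hy₀
  · simp only [ha, hb, dif_pos] at hab
    simpa using e.injective (Subtype.ext hab)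

theorem nonempty_of_mk_eq_aleph_one {X : Set ZFSet.{u}} (h : #X = ℵ₁) : X.Nonempty := by
  rw [Set.nonempty_iff_ne_empty]
  rintro rfl
  rw [Cardinal.mk_eq_zero] at h
  exact (Cardinal.aleph_pos 1).ne h

namespace SetPoset

variable {P : SetPoset.{u}}

/-- D may come from another cardinal and need not lie in H_χ. This is harmless because the hulls V d
are indexed by arbitrary sets d; only their values lie in H_χ. -/
theorem HasReflection.isStationary {D W : Set ZFSet.{u}} (hR : P.HasReflection D W)
    (hcD : (P.carrier : Set ZFSet.{u}) ⊆ D) (hW : #W = ℵ₁) {χ : Cardinal.{u}} (hχ : χ.IsRegular) (hκ : P.kappa < χ) :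
    IsStationary (H χ) (P.models χ) := by
  classical
  refine ⟨models_subset χ, fun 𝒞 h𝒞 => ?_⟩
  have h1 : ℵ₁ < χ := aleph_one_lt_of_kappa_lt hκ
  have hH : ℵ₁ ≤ #(H χ) := aleph_one_le_mk_H h1
  have hcode := code_mem_H hχ hκ
  obtain ⟨C, hC𝒞, hCmono⟩ := h𝒞.exists_assignment hH
  have hCcard : ∀ s, #(C s) = ℵ₁ := fun s => (h𝒞.1 (hC𝒞 s)).2
  have hCH : ∀ s, C s ⊆ H χ := fun s => (h𝒞.1 (hC𝒞 s)).1
  have hE : ∀ s, ∃ e : ZFSet.{u} → ZFSet.{u}, (∀ a, e a ∈ C s) ∧ ∀ y ∈ C s, ∃ a ∈ W, e a = y :=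
    fun s => exists_surjOn ((hCcard s).trans hW.symm) (nonempty_of_mk_eq_aleph_one (hCcard s))
  choose E hE1 hE2 using hE
  -- W may lie outside H_χ; an injective copy ξ '' W, with ξ d ∈ V d, forces M to have at least ℵ₁
  -- elements.
  obtain ⟨ξ, hξ1, hξ2⟩ := exists_injOn (hW.le.trans hH) ⟨_, hcode⟩
  obtain ⟨V, hVe, hVc, hVG, hVl, hVr, hVE, hVcov⟩ := exists_hulls hχ h1
    (fun d => {P.code, ξ d} ∪ {x | x = d ∧ d ∈ P.carrier})
    (fun d => by
      rintro x ((rfl | rfl) | ⟨rfl, hx⟩)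
      exacts [hcode, hξ1 d, mem_H_of_mem (carrier_mem_H hκ) hx])
    (fun d => ((Set.countable_singleton _).insert _).union
      (Set.Subsingleton.countable fun x hx y hy => hx.1.trans hy.1.symm))
    (fun a s => E s a) (fun a s _ => hCH s (hE1 s a))
  have hWinf : W.Infinite := by
    rw [← Set.infinite_coe_iff, Cardinal.infinite_iff, hW]
    exact Cardinal.aleph0_le_aleph 1
  let ν : ℕ → ZFSet.{u} := fun n => hWinf.natEmbedding W n
  have hνW : ∀ n, ν n ∈ W := fun n => (hWinf.natEmbedding W n).2
  have hν : Function.Injective ν := Subtype.val_injective.comp (hWinf.natEmbedding W).injective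
  have hen : ∀ d, ∃ e : ℕ → ZFSet.{u}, V d ⊆ Set.range e := fun d =>
    Set.countable_iff_exists_subset_range.1 (hVc d)
  choose en hen using hen
  -- f decodes `pair (ν n) d` as the n-th term of an enumeration covering V d, provided that term is
  -- in P ⊆ D, and is the identity elsewhere. Closure of N under f and pairing then gives P ∩ M ⊆ N.
  have hf : ∀ x, ∃ y, (x ∈ D → y ∈ D) ∧
      ∀ n d, x = pair (ν n) d → en d n ∈ P.carrier → y = en d n := by
    intro x
    by_cases h : ∃ n d, x = pair (ν n) d ∧ en d n ∈ P.carrier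
    · obtain ⟨n, d, rfl, hnd⟩ := h
      refine ⟨en d n, fun _ => hcD hnd, fun n' d' h' _ => ?_⟩
      obtain ⟨h2, rfl⟩ := pair_injective h'
      rw [hν h2]
    · exact ⟨x, id, fun n d h2 h3 => absurd ⟨n, d, h2, h3⟩ h⟩
  choose f hf1 hf2 using hf
  obtain ⟨N, -, hNc, hWN, hNp, hNf, hNcov, hσ⟩ := hR f hf1
  let M : Set ZFSet.{u} := ⋃ d : N, V d
  have hVM : ∀ d ∈ N, V d ⊆ M := fun d hd => Set.subset_iUnion (fun d : N => V d) ⟨d, hd⟩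
  have hmemM : ∀ x ∈ M, ∃ d ∈ N, x ∈ V d := fun x hx => by
    obtain ⟨d, hd⟩ := Set.mem_iUnion.1 hx
    exact ⟨d, d.2, hd⟩
  obtain ⟨w₀, hw₀⟩ := nonempty_of_mk_eq_aleph_one hW
  have : Nonempty N := ⟨⟨w₀, hWN hw₀⟩⟩
  have hMe : IsElementarySubmodel M (H χ) := by
    refine isElementarySubmodel_iUnion (fun d => hVe d) fun a b => ?_
    exact ⟨⟨_, hNp a a.2 b b.2⟩, hVl _ _, hVr _ _⟩
  have hMc : #M = ℵ₁ := by
    refine le_antisymm ?_ ?_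
    · have : M = ⋃₀ ((fun d => V d) '' N) := by
        rw [Set.sUnion_image]
        exact Set.iUnion_coe_set N _
      rw [this]
      refine mk_sUnion_le_aleph_one (Cardinal.mk_image_le.trans hNc) ?_
      rintro _ ⟨d, _, rfl⟩
      exact (hVc d).le_aleph0.trans (Cardinal.aleph0_le_aleph 1)
    · rw [← hW, ← Cardinal.mk_image_eq_of_injOn _ _ hξ2]
      refine Cardinal.mk_le_mk_of_subset ?_
      rintro _ ⟨d, hd, rfl⟩
      exact hVM d (hWN hd) (hVG d (Or.inl (Or.inr rfl)))
  -- Indices for the elements of Y are covered by a countable s ∈ N with s ⊆ N; the union of the V b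
  -- over b ∈ s is an element of V s ⊆ M.
  have hMcov : ∀ Y ⊆ M, Y.Countable → ∃ y ∈ M, Y ⊆ (y : Set ZFSet.{u}) ∧
      (y : Set ZFSet.{u}) ⊆ M ∧ (y : Set ZFSet.{u}).Countable := by
    intro Y hY hYc
    have hd : ∀ x : Y, ∃ d ∈ N, (x : ZFSet.{u}) ∈ V d := fun x => hmemM x (hY x.2)
    choose d hdN hd using hd
    have := hYc.to_subtype
    obtain ⟨s, hsN, hds, hsN', hsc⟩ := hNcov (Set.range d)
      (by rintro _ ⟨x, rfl⟩; exact hdN x) (Set.countable_range d)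
    obtain ⟨z, hz, hz'⟩ := hVcov s hsc
    refine ⟨z, hVM s hsN hz, ?_, ?_, ?_⟩
    · intro x hx
      rw [hz']
      exact Set.mem_iUnion₂.2 ⟨d ⟨x, hx⟩, hds ⟨_, rfl⟩, hd ⟨x, hx⟩⟩
    · rw [hz']
      exact Set.iUnion₂_subset fun b hb => hVM b (hsN' hb)
    · rw [hz']
      exact hsc.biUnion fun b _ => hVc b
  have hPM : (P.carrier : Set ZFSet.{u}) ∩ M = (P.carrier : Set ZFSet.{u}) ∩ N := by
    ext x
    refine and_congr_right fun hx => ⟨fun hxM => ?_, fun hxN => ?_⟩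
    · obtain ⟨d, hd, hxd⟩ := hmemM x hxM
      obtain ⟨n, rfl⟩ := hen d hxd
      rw [← hf2 _ n d rfl hx]
      exact hNf _ (hNp _ (hWN (hνW n)) _ hd)
    -- Conversely, p ∈ P ∩ N belongs to V p, because G p was made to contain p.
    · exact hVM x hxN (hVG x (Or.inr ⟨rfl, hx⟩))
  refine ⟨M, ⟨⟨hMe, hMc, ?_⟩, ?_, ?_⟩, ?_⟩
  · rintro Y ⟨hYM, hYc⟩
    obtain ⟨y, hyM, hYy, hyM', hyc⟩ := hMcov Y hYM (Cardinal.le_aleph0_iff_set_countable.1 hYc.le)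
    exact ⟨y, ⟨⟨hyM', le_antisymm hyc.le_aleph0
      (hYc.ge.trans (Cardinal.mk_le_mk_of_subset hYy))⟩, y, hyM, rfl⟩, hYy⟩
  · exact hVM w₀ (hWN hw₀) (hVG w₀ (Or.inl (Or.inl rfl)))
  · rw [hPM]
    exact hσ
  -- If s ∈ V d, the element of C s with index a ∈ W lies in V (pair a d), hence in M.
  · have hCM : ∀ s ∈ M, C s ⊆ M := by
      intro s hs x hx
      obtain ⟨d, hd, hsd⟩ := hmemM s hs
      obtain ⟨a, ha, rfl⟩ := hE2 s x hx
      exact hVM _ (hNp a (hWN ha) d hd) (hVE a d s hsd)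
    -- Covering by countable elements shows that the C s with s ∈ M exhaust M and form a σ-directed
    -- family.
    have hM𝒟 : M = ⋃₀ (C '' M) := by
      apply Set.Subset.antisymm
      · intro x hx
        obtain ⟨y, hyM, hxy, hyM', hyc⟩ := hMcov {x} (by simpa using hx) (Set.countable_singleton x)
        exact ⟨_, ⟨y, hyM, rfl⟩, (hCmono y hyc (hyM'.trans hMe.subset)).1 (hxy rfl)⟩
      · exact Set.sUnion_subset (by rintro _ ⟨s, hs, rfl⟩; exact hCM s hs)
    rw [hM𝒟]
    refine h𝒞.mem_of_sigmaDirected (by rintro _ ⟨s, _, rfl⟩; exact hC𝒞 s) ?_ (by rw [← hM𝒟, hMc])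
    intro 𝒟' h𝒟' h𝒟c
    choose s hsM hs using fun t : 𝒟' => h𝒟' t.2
    have := h𝒟c.to_subtype
    obtain ⟨y, hyM, hsy, hyM', hyc⟩ := hMcov (Set.range s)
      (by rintro _ ⟨t, rfl⟩; exact hsM t) (Set.countable_range s)
    refine ⟨_, ⟨y, hyM, rfl⟩, Set.sUnion_subset fun t ht => ?_⟩
    change ((⟨t, ht⟩ : 𝒟') : Set ZFSet.{u}) ⊆ C y
    rw [← hs]
    exact (hCmono y hyc (hyM'.trans hMe.subset)).2 _ (hsy ⟨_, rfl⟩)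

end SetPoset

/-! ### Definable relations -/

/-- `R` is defined over `(X, ∈)` by a first-order formula without parameters. -/
def IsDefinable {X : Set ZFSet.{u}} {α : Type} (R : (α → X) → Prop) : Prop :=
  ∃ φ : langSet.Formula α, ∀ v, φ.Realize v ↔ R v

namespace IsDefinable

variable {X : Set ZFSet.{u}} {α : Type} {R T : (α → X) → Prop}

theorem mem (a b : α) : IsDefinable fun v : α → X => (v a : ZFSet.{u}) ∈ (v b : ZFSet.{u}) :=
  ⟨memSymbol.formula₂ (.var a) (.var b), fun v => by
    rw [FirstOrder.Language.Formula.realize_rel₂, relMap_memSymbol]; rfl⟩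

theorem eq (a b : α) : IsDefinable fun v : α → X => v a = v b :=
  ⟨FirstOrder.Language.Term.equal (.var a) (.var b), fun v => by
    rw [FirstOrder.Language.Formula.realize_equal]; rfl⟩

theorem not (hR : IsDefinable R) : IsDefinable fun v => ¬R v := by
  obtain ⟨φ, hφ⟩ := hR
  exact ⟨φ.not, fun v => by rw [FirstOrder.Language.Formula.realize_not, hφ]⟩

theorem imp (hR : IsDefinable R) (hT : IsDefinable T) : IsDefinable fun v => R v → T v := by
  obtain ⟨φ, hφ⟩ := hR
  obtain ⟨ψ, hψ⟩ := hT
  exact ⟨φ.imp ψ, fun v => by rw [FirstOrder.Language.Formula.realize_imp, hφ, hψ]⟩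

theorem and (hR : IsDefinable R) (hT : IsDefinable T) : IsDefinable fun v => R v ∧ T v := by
  obtain ⟨φ, hφ⟩ := hR
  obtain ⟨ψ, hψ⟩ := hT
  exact ⟨φ ⊓ ψ, fun v => by rw [FirstOrder.Language.Formula.realize_inf, hφ, hψ]⟩

theorem or (hR : IsDefinable R) (hT : IsDefinable T) : IsDefinable fun v => R v ∨ T v := by
  obtain ⟨φ, hφ⟩ := hR
  obtain ⟨ψ, hψ⟩ := hT
  exact ⟨φ ⊔ ψ, fun v => by rw [FirstOrder.Language.Formula.realize_sup, hφ, hψ]⟩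

theorem iff (hR : IsDefinable R) (hT : IsDefinable T) : IsDefinable fun v => (R v ↔ T v) := by
  obtain ⟨φ, hφ⟩ := hR
  obtain ⟨ψ, hψ⟩ := hT
  exact ⟨φ.iff ψ, fun v => by rw [FirstOrder.Language.Formula.realize_iff, hφ, hψ]⟩

theorem exs {β : Type} [Finite β] {R : (α → X) → (β → X) → Prop}
    (hR : IsDefinable fun v : α ⊕ β → X => R (fun a => v (.inl a)) (fun b => v (.inr b))) :
    IsDefinable fun v => ∃ i, R v i := by
  obtain ⟨φ, hφ⟩ := hR
  refine ⟨φ.iExs β, fun v => ?_⟩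
  rw [FirstOrder.Language.Formula.realize_iExs]
  exact exists_congr fun i => hφ _

theorem ex {R : (α → X) → X → Prop}
    (hR : IsDefinable fun v : α ⊕ Unit → X => R (fun a => v (.inl a)) (v (.inr ()))) :
    IsDefinable fun v => ∃ x, R v x := by
  have h := exs (R := fun v i => R v (i ())) hR
  have h' : (fun v : α → X => ∃ x, R v x) = fun v => ∃ i : Unit → X, R v (i ()) := by
    funext v
    exact propext ⟨fun ⟨x, hx⟩ => ⟨fun _ => x, hx⟩, fun ⟨i, hi⟩ => ⟨_, hi⟩⟩
  rwa [h']

theorem all {R : (α → X) → X → Prop}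
    (hR : IsDefinable fun v : α ⊕ Unit → X => R (fun a => v (.inl a)) (v (.inr ()))) :
    IsDefinable fun v => ∀ x, R v x := by
  have h := (ex (R := fun v x => ¬R v x) hR.not).not
  simpa only [not_exists, not_not] using h

end IsDefinable

/-- The form in which elementarity is used below: the existential formula passes down to the
substructure, and its instance at the witnesses passes back up. Several witnesses are found at once.
-/
theorem IsElementarySubmodel.exists_forall_mem {M X : Set ZFSet.{u}}
    (h : IsElementarySubmodel M X) {α β : Type} [Finite β] {R : (α → X) → (β → X) → Prop}
    (hR : IsDefinable fun v : α ⊕ β → X => R (fun a => v (.inl a)) (fun b => v (.inr b)))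
    (v : α → X) (hv : ∀ a, (v a : ZFSet.{u}) ∈ M) (hex : ∃ i, R v i) :
    ∃ i, (∀ b, (i b : ZFSet.{u}) ∈ M) ∧ R v i := by
  obtain ⟨φ, hφ⟩ := hR
  obtain ⟨S, rfl⟩ := h
  have hvS : ∀ a, v a ∈ S := fun a => by
    obtain ⟨x, hx, hxv⟩ := hv a
    rwa [← Subtype.ext hxv]
  let w : α → S := fun a => ⟨v a, hvS a⟩
  have h1 : (φ.iExs β).Realize (S.subtype ∘ w) := by
    rw [FirstOrder.Language.Formula.realize_iExs]
    obtain ⟨i, hi⟩ := hex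
    exact ⟨i, (hφ _).2 hi⟩
  rw [S.subtype.map_formula, FirstOrder.Language.Formula.realize_iExs] at h1
  obtain ⟨i, hi⟩ := h1
  rw [← S.subtype.map_formula, hφ] at hi
  exact ⟨fun b => i b, fun b => ⟨i b, (i b).2, rfl⟩, hi⟩

theorem IsElementarySubmodel.exists_mem {M X : Set ZFSet.{u}}
    (h : IsElementarySubmodel M X) {α : Type} {R : (α → X) → X → Prop}
    (hR : IsDefinable fun v : α ⊕ Unit → X => R (fun a => v (.inl a)) (v (.inr ())))
    (v : α → X) (hv : ∀ a, (v a : ZFSet.{u}) ∈ M) (hex : ∃ x, R v x) :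
    ∃ x : X, (x : ZFSet.{u}) ∈ M ∧ R v x := by
  obtain ⟨x, hx⟩ := hex
  obtain ⟨i, hi, hi'⟩ := h.exists_forall_mem (R := fun v i => R v (i ())) hR v hv ⟨fun _ => x, hx⟩
  exact ⟨_, hi (), hi'⟩

/-- `X` is transitive and has its countable subsets as elements. -/
structure IsCountablyClosed (X : Set ZFSet.{u}) : Prop where
  mem_of_mem : ∀ x ∈ X, ∀ y ∈ x, y ∈ X
  mem_of_countable : ∀ y : ZFSet.{u}, (y : Set ZFSet.{u}) ⊆ X → (y : Set ZFSet.{u}).Countable → y ∈ X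

theorem isCountablyClosed_H {χ : Cardinal.{u}} (hχ : χ.IsRegular) (h : ℵ₀ < χ) :
    IsCountablyClosed (H χ) :=
  ⟨fun _ hx _ hy => mem_H_of_mem hx hy, fun _ h1 h2 => mem_H_of_countable hχ h h2 h1⟩

namespace IsCountablyClosed

variable {X : Set ZFSet.{u}}

theorem doubleton_mem (hX : IsCountablyClosed X) {a b : ZFSet.{u}} (ha : a ∈ X) (hb : b ∈ X) :
    ({a, b} : ZFSet.{u}) ∈ X :=
  doubleton_mem_of_countable_closed hX.mem_of_countable ha hb

theorem pair_mem (hX : IsCountablyClosed X) {a b : ZFSet.{u}} (ha : a ∈ X) (hb : b ∈ X) : pair a b ∈ X :=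
  pair_mem_of_countable_closed hX.mem_of_countable ha hb

theorem ext_iff (hX : IsCountablyClosed X) {p : X} {q : ZFSet.{u}} (hq : q ∈ X) :
    (p : ZFSet.{u}) = q ↔ ∀ x : X, (x : ZFSet.{u}) ∈ (p : ZFSet.{u}) ↔ (x : ZFSet.{u}) ∈ q := by
  refine ⟨fun h x => by rw [h], fun h => ZFSet.ext fun x => ⟨fun hx => ?_, fun hx => ?_⟩⟩
  · exact (h ⟨x, hX.mem_of_mem _ p.2 _ hx⟩).1 hx
  · exact (h ⟨x, hX.mem_of_mem _ hq _ hx⟩).2 hx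

theorem isDefinable_eq_doubleton (hX : IsCountablyClosed X) {α : Type} (p a b : α) :
    IsDefinable fun v : α → X => (v p : ZFSet.{u}) = {(v a : ZFSet.{u}), (v b : ZFSet.{u})} := by
  have h : (fun v : α → X => (v p : ZFSet.{u}) = {(v a : ZFSet.{u}), (v b : ZFSet.{u})}) =
      fun v => ∀ x : X, (x : ZFSet.{u}) ∈ (v p : ZFSet.{u}) ↔ x = v a ∨ x = v b := by
    funext v
    rw [hX.ext_iff (hX.doubleton_mem (v a).2 (v b).2)]
    simp only [ZFSet.mem_pair, Subtype.ext_iff]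
  rw [h]
  exact .all (.iff (.mem _ _) (.or (.eq _ _) (.eq _ _)))

/-- A Kuratowski pair is three doubletons, with {a} read as {a, a}; countable closure puts the inner
ones in X. -/
theorem isDefinable_eq_pair (hX : IsCountablyClosed X) {α : Type} (p a b : α) :
    IsDefinable fun v : α → X => (v p : ZFSet.{u}) = pair (v a) (v b) := by
  have h : (fun v : α → X => (v p : ZFSet.{u}) = pair (v a) (v b)) =
      fun v => ∃ s t : X, (s : ZFSet.{u}) = {(v a : ZFSet.{u}), (v a : ZFSet.{u})} ∧
        (t : ZFSet.{u}) = {(v a : ZFSet.{u}), (v b : ZFSet.{u})} ∧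
        (v p : ZFSet.{u}) = {(s : ZFSet.{u}), (t : ZFSet.{u})} := by
    funext v
    refine propext ⟨fun h => ?_, ?_⟩
    · refine ⟨⟨_, hX.doubleton_mem (v a).2 (v a).2⟩, ⟨_, hX.doubleton_mem (v a).2 (v b).2⟩,
        rfl, rfl, ?_⟩
      rw [h]
      change pair _ _ = {{_, _}, {_, _}}
      rw [pair_eq_singleton]
      rfl
    · rintro ⟨s, t, hs, ht, h⟩
      rw [h, hs, ht, pair_eq_singleton]
      rfl
  rw [h]
  exact .ex (.ex (.and (hX.isDefinable_eq_doubleton _ _ _)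
    (.and (hX.isDefinable_eq_doubleton _ _ _) (hX.isDefinable_eq_doubleton _ _ _))))

theorem isDefinable_pair_mem (hX : IsCountablyClosed X) {α : Type} (a b g : α) :
    IsDefinable fun v : α → X => pair (v a) (v b) ∈ (v g : ZFSet.{u}) := by
  have h : (fun v : α → X => pair (v a) (v b) ∈ (v g : ZFSet.{u})) =
      fun v => ∃ p : X, (p : ZFSet.{u}) = pair (v a) (v b) ∧ (p : ZFSet.{u}) ∈ (v g : ZFSet.{u}) := by
    funext v
    refine propext ⟨fun h => ⟨⟨_, hX.pair_mem (v a).2 (v b).2⟩, rfl, h⟩, ?_⟩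
    rintro ⟨p, hp, h⟩
    rwa [← hp]
  rw [h]
  exact .ex (.and (hX.isDefinable_eq_pair _ _ _) (.mem _ _))

end IsCountablyClosed

/-! ### Failure of reflection as a first-order formula over H_χ -/

section Internal

variable {X : Set ZFSet.{u}}

/-- Internally to `X`, `g` is a partial surjection of `o` onto a superset of `y`. -/
def IsEnumeration (g o y : X) : Prop :=
  (∀ x : X, (x : ZFSet.{u}) ∈ (y : ZFSet.{u}) →
      ∃ a : X, (a : ZFSet.{u}) ∈ (o : ZFSet.{u}) ∧ pair a x ∈ (g : ZFSet.{u})) ∧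
    ∀ a x x' : X, pair a x ∈ (g : ZFSet.{u}) → pair a x' ∈ (g : ZFSet.{u}) → x = x'

/-- Internally to `X`, there is a partial surjection of `o` onto a superset of `y`. -/
def Enumerates (o y : X) : Prop :=
  ∃ g : X, IsEnumeration g o y

/-- Internally to `X`, `b = a ∪ {a}`. -/
def IsSucc (b a : X) : Prop :=
  ∀ x : X, (x : ZFSet.{u}) ∈ (b : ZFSet.{u}) ↔ (x : ZFSet.{u}) ∈ (a : ZFSet.{u}) ∨ x = a

/-- Internally to `X`, `z = ∅`. -/
def IsEmptySet (z : X) : Prop :=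
  ∀ x : X, (x : ZFSet.{u}) ∉ (z : ZFSet.{u})

/-- Internally to `X`, `o = ω`. -/
def IsOmega (o : X) : Prop :=
  (∃ z : X, (z : ZFSet.{u}) ∈ (o : ZFSet.{u}) ∧ IsEmptySet z) ∧
  (∀ a : X, (a : ZFSet.{u}) ∈ (o : ZFSet.{u}) →
    ∃ b : X, (b : ZFSet.{u}) ∈ (o : ZFSet.{u}) ∧ IsSucc b a) ∧
  ∀ a : X, (a : ZFSet.{u}) ∈ (o : ZFSet.{u}) → IsEmptySet a ∨
    ∃ b : X, (b : ZFSet.{u}) ∈ (o : ZFSet.{u}) ∧ (b : ZFSet.{u}) ∈ (a : ZFSet.{u}) ∧ IsSucc a b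

/-- Internally to `X`, `c ∩ N ≤_σ c`, for the relation `r` on `c`. -/
def InternalLeSigma (o c r N : X) : Prop :=
  ∀ p : X, (p : ZFSet.{u}) ∈ (c : ZFSet.{u}) →
    (∃ C : X, Enumerates o C ∧
      (∀ q : X, (q : ZFSet.{u}) ∈ (C : ZFSet.{u}) → (q : ZFSet.{u}) ∈ (c : ZFSet.{u}) ∧
        (q : ZFSet.{u}) ∈ (N : ZFSet.{u}) ∧ pair q p ∈ (r : ZFSet.{u})) ∧
      ∀ q : X, (q : ZFSet.{u}) ∈ (c : ZFSet.{u}) → (q : ZFSet.{u}) ∈ (N : ZFSet.{u}) →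
        pair q p ∈ (r : ZFSet.{u}) →
        ∃ x : X, (x : ZFSet.{u}) ∈ (C : ZFSet.{u}) ∧ pair q x ∈ (r : ZFSet.{u})) ∧
    ∃ C : X, Enumerates o C ∧
      (∀ q : X, (q : ZFSet.{u}) ∈ (C : ZFSet.{u}) → (q : ZFSet.{u}) ∈ (c : ZFSet.{u}) ∧
        (q : ZFSet.{u}) ∈ (N : ZFSet.{u}) ∧ pair p q ∈ (r : ZFSet.{u})) ∧
      ∀ q : X, (q : ZFSet.{u}) ∈ (c : ZFSet.{u}) → (q : ZFSet.{u}) ∈ (N : ZFSet.{u}) →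
        pair p q ∈ (r : ZFSet.{u}) →
        ∃ x : X, (x : ZFSet.{u}) ∈ (C : ZFSet.{u}) ∧ pair x q ∈ (r : ZFSet.{u})

/-- Internally to `X`, `y ⊆ z`. -/
def InternalSubset (y z : X) : Prop :=
  ∀ x : X, (x : ZFSet.{u}) ∈ (y : ZFSet.{u}) → (x : ZFSet.{u}) ∈ (z : ZFSet.{u})

/-- Internally to `X`, `N` is a closed set as in `SetPoset.HasReflection`. -/
def IsReflecting (c r D f w o N : X) : Prop :=
  InternalSubset N D ∧ Enumerates w N ∧ InternalSubset w N ∧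
  (∀ a b : X, (a : ZFSet.{u}) ∈ (N : ZFSet.{u}) → (b : ZFSet.{u}) ∈ (N : ZFSet.{u}) →
    pair a b ∈ (N : ZFSet.{u})) ∧
  (∀ a : X, (a : ZFSet.{u}) ∈ (N : ZFSet.{u}) →
    ∃ b : X, (b : ZFSet.{u}) ∈ (N : ZFSet.{u}) ∧ pair a b ∈ (f : ZFSet.{u})) ∧
  (∀ Y : X, InternalSubset Y N → Enumerates o Y →
    ∃ y : X, (y : ZFSet.{u}) ∈ (N : ZFSet.{u}) ∧ InternalSubset Y y ∧ InternalSubset y N ∧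
      Enumerates o y) ∧
  InternalLeSigma o c r N

/-- Internally to `X`, `f` is a counterexample to `SetPoset.HasReflection`, for the index set `w`
that resembles `ω₁`. -/
def IsCounterexample (c r D f w o : X) : Prop :=
  IsOmega o ∧
  (∀ a b : X, (a : ZFSet.{u}) ∈ (w : ZFSet.{u}) → (b : ZFSet.{u}) ∈ (w : ZFSet.{u}) →
    (a : ZFSet.{u}) ∈ (b : ZFSet.{u}) ∨ a = b ∨ (b : ZFSet.{u}) ∈ (a : ZFSet.{u})) ∧
  (∀ a : X, (a : ZFSet.{u}) ∈ (w : ZFSet.{u}) → Enumerates o a) ∧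
  (∀ y : X, Enumerates o y → ∃ a : X, (a : ZFSet.{u}) ∈ (w : ZFSet.{u}) ∧
    ∀ b : X, (b : ZFSet.{u}) ∈ (y : ZFSet.{u}) → (b : ZFSet.{u}) ∈ (w : ZFSet.{u}) →
      (b : ZFSet.{u}) ∈ (a : ZFSet.{u})) ∧
  InternalSubset w D ∧ InternalSubset c D ∧
  (∀ y : X, Enumerates o y → InternalSubset y D → (y : ZFSet.{u}) ∈ (D : ZFSet.{u})) ∧
  (∀ a : X, (a : ZFSet.{u}) ∈ (D : ZFSet.{u}) →
    ∃ b : X, (b : ZFSet.{u}) ∈ (D : ZFSet.{u}) ∧ pair a b ∈ (f : ZFSet.{u})) ∧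
  ∀ N : X, ¬IsReflecting c r D f w o N

variable {α : Type}

theorem IsCountablyClosed.isDefinable_isEnumeration (hX : IsCountablyClosed X) (g o y : α) :
    IsDefinable fun v : α → X => IsEnumeration (v g) (v o) (v y) :=
  .and (.all (.imp (.mem _ _) (.ex (.and (.mem _ _) (hX.isDefinable_pair_mem _ _ _)))))
    (.all (.all (.all (.imp (hX.isDefinable_pair_mem _ _ _)
      (.imp (hX.isDefinable_pair_mem _ _ _) (.eq _ _))))))

theorem IsCountablyClosed.isDefinable_enumerates (hX : IsCountablyClosed X) (o y : α) :
    IsDefinable fun v : α → X => Enumerates (v o) (v y) :=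
  .ex (hX.isDefinable_isEnumeration _ _ _)

theorem isDefinable_isSucc (b a : α) : IsDefinable fun v : α → X => IsSucc (v b) (v a) :=
  .all (.iff (.mem _ _) (.or (.mem _ _) (.eq _ _)))

theorem isDefinable_isEmptySet (z : α) : IsDefinable fun v : α → X => IsEmptySet (v z) :=
  .all (.not (.mem _ _))

theorem isDefinable_isOmega (o : α) : IsDefinable fun v : α → X => IsOmega (v o) :=
  .and (.ex (.and (.mem _ _) (isDefinable_isEmptySet _)))
    (.and (.all (.imp (.mem _ _) (.ex (.and (.mem _ _) (isDefinable_isSucc _ _)))))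
      (.all (.imp (.mem _ _) (.or (isDefinable_isEmptySet _)
        (.ex (.and (.mem _ _) (.and (.mem _ _) (isDefinable_isSucc _ _))))))))

theorem isDefinable_internalSubset (y z : α) :
    IsDefinable fun v : α → X => InternalSubset (v y) (v z) :=
  .all (.imp (.mem _ _) (.mem _ _))

theorem IsCountablyClosed.isDefinable_internalLeSigma (hX : IsCountablyClosed X) (o c r N : α) :
    IsDefinable fun v : α → X => InternalLeSigma (v o) (v c) (v r) (v N) :=
  .all (.imp (.mem _ _) (.and
    (.ex (.and (hX.isDefinable_enumerates _ _)
      (.and (.all (.imp (.mem _ _) (.and (.mem _ _)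
          (.and (.mem _ _) (hX.isDefinable_pair_mem _ _ _)))))
        (.all (.imp (.mem _ _) (.imp (.mem _ _) (.imp (hX.isDefinable_pair_mem _ _ _)
          (.ex (.and (.mem _ _) (hX.isDefinable_pair_mem _ _ _))))))))))
    (.ex (.and (hX.isDefinable_enumerates _ _)
      (.and (.all (.imp (.mem _ _) (.and (.mem _ _)
          (.and (.mem _ _) (hX.isDefinable_pair_mem _ _ _)))))
        (.all (.imp (.mem _ _) (.imp (.mem _ _) (.imp (hX.isDefinable_pair_mem _ _ _)
          (.ex (.and (.mem _ _) (hX.isDefinable_pair_mem _ _ _))))))))))))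

theorem IsCountablyClosed.isDefinable_isReflecting (hX : IsCountablyClosed X)
    (c r D f w o N : α) :
    IsDefinable fun v : α → X => IsReflecting (v c) (v r) (v D) (v f) (v w) (v o) (v N) :=
  .and (isDefinable_internalSubset _ _) (.and (hX.isDefinable_enumerates _ _)
    (.and (isDefinable_internalSubset _ _) (.and
      (.all (.all (.imp (.mem _ _) (.imp (.mem _ _) (hX.isDefinable_pair_mem _ _ _))))) (.and
      (.all (.imp (.mem _ _) (.ex (.and (.mem _ _) (hX.isDefinable_pair_mem _ _ _))))) (.and
      (.all (.imp (isDefinable_internalSubset _ _) (.imp (hX.isDefinable_enumerates _ _)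
        (.ex (.and (.mem _ _) (.and (isDefinable_internalSubset _ _)
          (.and (isDefinable_internalSubset _ _) (hX.isDefinable_enumerates _ _))))))))
      (hX.isDefinable_internalLeSigma _ _ _ _))))))

theorem IsCountablyClosed.isDefinable_isCounterexample (hX : IsCountablyClosed X)
    (c r D f w o : α) :
    IsDefinable fun v : α → X => IsCounterexample (v c) (v r) (v D) (v f) (v w) (v o) :=
  .and (isDefinable_isOmega _) (.and
    (.all (.all (.imp (.mem _ _) (.imp (.mem _ _) (.or (.mem _ _) (.or (.eq _ _) (.mem _ _)))))))
    (.and (.all (.imp (.mem _ _) (hX.isDefinable_enumerates _ _))) (.and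
    (.all (.imp (hX.isDefinable_enumerates _ _) (.ex (.and (.mem _ _)
      (.all (.imp (.mem _ _) (.imp (.mem _ _) (.mem _ _))))))))
    (.and (isDefinable_internalSubset _ _) (.and (isDefinable_internalSubset _ _) (.and
    (.all (.imp (hX.isDefinable_enumerates _ _) (.imp (isDefinable_internalSubset _ _)
      (.mem _ _)))) (.and
    (.all (.imp (.mem _ _) (.ex (.and (.mem _ _) (hX.isDefinable_pair_mem _ _ _)))))
    (.all (.not (hX.isDefinable_isReflecting _ _ _ _ _ _ _))))))))))

theorem IsCountablyClosed.internalSubset_iff (hX : IsCountablyClosed X) {y z : X} :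
    InternalSubset y z ↔ (y : ZFSet.{u}) ⊆ (z : ZFSet.{u}) :=
  ⟨fun h x hx => h ⟨x, hX.mem_of_mem _ y.2 _ hx⟩ hx, fun h _ hx => h hx⟩

theorem IsCountablyClosed.isEmptySet_iff (hX : IsCountablyClosed X) {z : X} :
    IsEmptySet z ↔ (z : ZFSet.{u}) = ∅ := by
  rw [ZFSet.eq_empty]
  exact ⟨fun h x hx => h ⟨x, hX.mem_of_mem _ z.2 _ hx⟩ hx, fun h x => h x⟩

theorem IsCountablyClosed.isSucc_iff (hX : IsCountablyClosed X) {b a : X} :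
    IsSucc b a ↔ (b : ZFSet.{u}) = insert (a : ZFSet.{u}) (a : ZFSet.{u}) := by
  refine ⟨fun h => ?_, fun h x => by rw [h, ZFSet.mem_insert_iff, Subtype.ext_iff, or_comm]⟩
  ext x
  rw [ZFSet.mem_insert_iff]
  constructor
  · intro hx
    rcases (h ⟨x, hX.mem_of_mem _ b.2 _ hx⟩).1 hx with h' | h'
    · exact Or.inr h'
    · exact Or.inl (congrArg Subtype.val h')
  · rintro (rfl | hx)
    · exact (h a).2 (Or.inr rfl)
    · exact (h ⟨x, hX.mem_of_mem _ a.2 _ hx⟩).2 (Or.inl hx)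

theorem IsCountablyClosed.mk_le_of_enumerates (hX : IsCountablyClosed X) {o y : X}
    (h : Enumerates o y) :
    #((y : ZFSet.{u}) : Set ZFSet.{u}) ≤ #((o : ZFSet.{u}) : Set ZFSet.{u}) := by
  obtain ⟨g, hg1, hg2⟩ := h
  have h : ∀ x : ((y : ZFSet.{u}) : Set ZFSet.{u}),
      ∃ a ∈ (o : ZFSet.{u}), pair a x ∈ (g : ZFSet.{u}) := fun x => by
    obtain ⟨a, ha, hax⟩ := hg1 ⟨x, hX.mem_of_mem _ y.2 _ x.2⟩ x.2
    exact ⟨a, ha, hax⟩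
  choose e he1 he2 using h
  refine Cardinal.mk_le_of_injective (f := fun x => ⟨e x, he1 x⟩) fun x x' hxx' => ?_
  have h3 : e x = e x' := congrArg Subtype.val hxx'
  have h4 := he2 x'
  rw [← h3] at h4
  have h5 := hg2 ⟨e x, hX.mem_of_mem _ o.2 _ (he1 x)⟩ ⟨x, hX.mem_of_mem _ y.2 _ x.2⟩
    ⟨x', hX.mem_of_mem _ y.2 _ x'.2⟩ (he2 x) h4
  exact Subtype.ext (Subtype.mk.inj h5)

/-- Descent through predecessors inside o terminates by ∈-induction, so no nonstandard elements
occur. -/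
theorem IsOmega.eq_iterate (hX : IsCountablyClosed X) {o : X} (ho : IsOmega o) (a : ZFSet.{u})
    (ha : a ∈ (o : ZFSet.{u})) : ∃ n : ℕ, a = (fun x => insert x x)^[n] ∅ := by
  induction a using ZFSet.inductionOn with
  | _ a ih =>
    rcases ho.2.2 ⟨a, hX.mem_of_mem _ o.2 _ ha⟩ ha with h | ⟨b, hb, hba, h⟩
    · exact ⟨0, hX.isEmptySet_iff.1 h⟩
    · obtain ⟨n, hn⟩ := ih b hba hb
      refine ⟨n + 1, (hX.isSucc_iff.1 h).trans ?_⟩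
      rw [Function.iterate_succ_apply', ← hn]

theorem IsOmega.iterate_mem (hX : IsCountablyClosed X) {o : X} (ho : IsOmega o) (n : ℕ) :
    (fun x => insert x x)^[n] ∅ ∈ (o : ZFSet.{u}) := by
  induction n with
  | zero =>
    obtain ⟨z, hz, hz'⟩ := ho.1
    rw [hX.isEmptySet_iff] at hz'
    rwa [hz'] at hz
  | succ n ih =>
    obtain ⟨b, hb, hb'⟩ := ho.2.1 ⟨_, hX.mem_of_mem _ o.2 _ ih⟩ ih
    rw [hX.isSucc_iff] at hb'
    rw [Function.iterate_succ_apply']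
    rwa [hb'] at hb

/-- Rank separates the iterates, which shows that o is infinite. -/
theorem rank_iterate_insert (n : ℕ) :
    rank ((fun x : ZFSet.{u} => insert x x)^[n] ∅) = n := by
  induction n with
  | zero => simp
  | succ n ih =>
    rw [Function.iterate_succ_apply', rank_insert, ih]
    simp

theorem IsOmega.mk_eq (hX : IsCountablyClosed X) {o : X} (ho : IsOmega o) :
    #((o : ZFSet.{u}) : Set ZFSet.{u}) = ℵ₀ := by
  refine le_antisymm ?_ ?_
  · rw [Cardinal.le_aleph0_iff_set_countable]
    refine (Set.countable_range fun n : ℕ => (fun x => insert x x)^[n] ∅).mono fun a ha => ?_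
    obtain ⟨n, rfl⟩ := ho.eq_iterate hX a ha
    exact ⟨n, rfl⟩
  · rw [← Cardinal.infinite_iff]
    refine Infinite.of_injective (fun n : ℕ =>
      (⟨_, ho.iterate_mem hX n⟩ : ((o : ZFSet.{u}) : Set ZFSet.{u}))) fun m n h => ?_
    have h1 := congrArg rank (congrArg Subtype.val h)
    simpa only [rank_iterate_insert, Nat.cast_inj] using h1

end Internal

/-! ### Absoluteness for H_χ -/

section InternalH

variable {χ : Cardinal.{u}}

/-- From an injection y → o, the reversed graph has at most |y| < χ elements, all pairs from H_χ, so
it is itself in H_χ. -/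
theorem enumerates_iff (hχ : χ.IsRegular) (h0 : ℵ₀ < χ) {o y : H χ} :
    Enumerates o y ↔ #((y : ZFSet.{u}) : Set ZFSet.{u}) ≤ #((o : ZFSet.{u}) : Set ZFSet.{u}) := by
  have hX := isCountablyClosed_H hχ h0
  refine ⟨hX.mk_le_of_enumerates, fun h => ?_⟩
  obtain ⟨e⟩ := Cardinal.le_def _ _ |>.1 h
  let F : ((y : ZFSet.{u}) : Set ZFSet.{u}) → ZFSet.{u} := fun x => pair (e x) x
  have hs : Small.{u} ((y : ZFSet.{u}) : Set ZFSet.{u}) := small_coe _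
  obtain ⟨g, hg⟩ := exists_coe_eq (Set.range F)
  have hgm : ∀ p, p ∈ g ↔ ∃ x, F x = p := fun p => by
    change p ∈ (g : Set ZFSet.{u}) ↔ _
    rw [hg]
    rfl
  have hgH : g ∈ H χ := by
    refine mem_H_of_forall_mem hχ ?_ fun p hp => ?_
    · have h1 : #(g : Set ZFSet.{u}) ≤ #((y : ZFSet.{u}) : Set ZFSet.{u}) := by
        rw [hg]
        exact Cardinal.mk_range_le
      rw [mk_coe, mk_coe, Cardinal.lift_le] at h1
      exact h1.trans_lt (card_lt_of_mem_H y.2)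
    · obtain ⟨x, rfl⟩ := (hgm p).1 hp
      exact pair_mem_H hχ h0 (mem_H_of_mem o.2 (e x).2) (mem_H_of_mem y.2 x.2)
  refine ⟨⟨g, hgH⟩, fun x hx => ?_, fun a x x' h1 h2 => ?_⟩
  · exact ⟨⟨e ⟨x, hx⟩, mem_H_of_mem o.2 (e ⟨x, hx⟩).2⟩, (e ⟨x, hx⟩).2, (hgm _).2 ⟨⟨x, hx⟩, rfl⟩⟩
  · obtain ⟨z, hz⟩ := (hgm _).1 h1
    obtain ⟨z', hz'⟩ := (hgm _).1 h2
    obtain ⟨h3, h4⟩ := pair_injective hz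
    obtain ⟨h5, h6⟩ := pair_injective hz'
    have h7 : z = z' := e.injective (Subtype.ext (h3.trans h5.symm))
    exact Subtype.ext (h4.symm.trans ((congrArg Subtype.val h7).trans h6))

theorem IsOmega.enumerates_iff (hχ : χ.IsRegular) (h0 : ℵ₀ < χ) {o y : H χ} (ho : IsOmega o) :
    Enumerates o y ↔ ((y : ZFSet.{u}) : Set ZFSet.{u}).Countable := by
  rw [SepPrinciple.enumerates_iff hχ h0, ho.mk_eq (isCountablyClosed_H hχ h0),
    Cardinal.le_aleph0_iff_set_countable]

theorem internalLeSigma_iff (hχ : χ.IsRegular) (h0 : ℵ₀ < χ) {P : SetPoset.{u}} {o c r N : H χ}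
    (ho : IsOmega o) (hc : (c : ZFSet.{u}) = P.carrier) (hr : (r : ZFSet.{u}) = P.rel) :
    InternalLeSigma o c r N ↔
      P.LeSigma ((P.carrier : Set ZFSet.{u}) ∩ ((N : ZFSet.{u}) : Set ZFSet.{u})) := by
  have hcH : ∀ x ∈ P.carrier, x ∈ H χ := fun x hx => mem_H_of_mem c.2 (by rwa [hc])
  -- Countable subsets of P are elements of H_χ, so the quantifier over C is absolute. Abstract R
  -- and T serve the cofinal and the coinitial half alike.
  have key : ∀ R : ZFSet.{u} → Prop, ∀ T : ZFSet.{u} → ZFSet.{u} → Prop,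
      (∃ C : H χ, Enumerates o C ∧
        (∀ q : H χ, (q : ZFSet.{u}) ∈ (C : ZFSet.{u}) → (q : ZFSet.{u}) ∈ P.carrier ∧
          (q : ZFSet.{u}) ∈ (N : ZFSet.{u}) ∧ R q) ∧
        ∀ q : H χ, (q : ZFSet.{u}) ∈ P.carrier → (q : ZFSet.{u}) ∈ (N : ZFSet.{u}) → R q →
          ∃ x : H χ, (x : ZFSet.{u}) ∈ (C : ZFSet.{u}) ∧ T q x) ↔
      ∃ C ⊆ {q ∈ (P.carrier : Set ZFSet.{u}) ∩ ((N : ZFSet.{u}) : Set ZFSet.{u}) | R q},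
        C.Countable ∧ ∀ q ∈ (P.carrier : Set ZFSet.{u}) ∩ ((N : ZFSet.{u}) : Set ZFSet.{u}),
          R q → ∃ x ∈ C, T q x := by
    intro R T
    constructor
    · rintro ⟨C, h1, h2, h3⟩
      refine ⟨(C : ZFSet.{u}), fun q hq => ?_, (ho.enumerates_iff hχ h0).1 h1, fun q hq hRq => ?_⟩
      · obtain ⟨h4, h5, h6⟩ := h2 ⟨q, mem_H_of_mem C.2 hq⟩ hq
        exact ⟨⟨h4, h5⟩, h6⟩
      · obtain ⟨x, hx, hT⟩ := h3 ⟨q, hcH q hq.1⟩ hq.1 hq.2 hRq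
        exact ⟨x, hx, hT⟩
    · rintro ⟨C, h1, h2, h3⟩
      have := h2.to_subtype
      obtain ⟨C, rfl⟩ := exists_coe_eq C
      refine ⟨⟨C, mem_H_of_countable hχ h0 h2 fun q hq => hcH q (h1 hq).1.1⟩,
        (ho.enumerates_iff hχ h0).2 h2, fun q hq => ?_, fun q hq hqN hRq => ?_⟩
      · exact ⟨(h1 hq).1.1, (h1 hq).1.2, (h1 hq).2⟩
      · obtain ⟨x, hx, hT⟩ := h3 q ⟨hq, hqN⟩ hRq
        exact ⟨⟨x, hcH x (h1 hx).1.1⟩, hx, hT⟩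
  unfold InternalLeSigma SetPoset.LeSigma
  rw [hc, hr]
  constructor
  · intro h
    refine ⟨Set.inter_subset_left, fun p hp => ?_⟩
    obtain ⟨h1, h2⟩ := h ⟨p, hcH p hp⟩ hp
    exact ⟨(key (fun q => P.Le q p) P.Le).1 h1,
      (key (fun q => P.Le p q) fun q x => P.Le x q).1 h2⟩
  · rintro ⟨-, h⟩ p hp
    obtain ⟨h1, h2⟩ := h p hp
    exact ⟨(key (fun q => P.Le q p) P.Le).2 h1,
      (key (fun q => P.Le p q) fun q x => P.Le x q).2 h2⟩

end InternalH

/-! ### The set D, and the sets ω and ω₁ -/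

/-- A transitive set of size at most `2 ^ κ` closed under countable subsets. -/
theorem exists_countably_closed_set {κ : Cardinal.{u}} (hκ : ℵ₀ ≤ κ) (t : ZFSet.{u})
    (ht : t.IsTransitive) (htc : t.card ≤ κ) (hte : ∅ ∈ t) :
    ∃ D : ZFSet.{u}, t ⊆ D ∧ D.IsTransitive ∧ D.card ≤ 2 ^ κ ∧
      ∀ y : ZFSet.{u}, y ⊆ D → (y : Set ZFSet.{u}).Countable → y ∈ D := by
  -- Well-founded trees with leaves labelled by elements of t and ℕ-branching nodes. A node
  -- evaluates to the set of values of its children, and D is the set of all values. There are at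
  -- most 2^κ trees because (2^κ)^ℵ₀ = 2^κ.
  let β : Shrink.{u} t ⊕ PUnit.{u + 1} → Type u :=
    Sum.elim (fun _ => PEmpty.{u + 1}) fun _ => ULift.{u} ℕ
  have hW : #(WType β) ≤ 2 ^ κ := by
    refine WType.cardinalMk_le_of_le ?_
    have h2 : ℵ₀ ≤ (2 : Cardinal.{u}) ^ κ := hκ.trans (Cardinal.cantor κ).le
    have hα : #(Shrink.{u} t ⊕ PUnit.{u + 1}) ≤ 2 ^ κ := by
      rw [Cardinal.mk_sum, Cardinal.lift_id, Cardinal.lift_id, Cardinal.mk_punit]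
      exact Cardinal.add_le_of_le h2 (htc.trans (Cardinal.cantor κ).le)
        (Cardinal.one_le_aleph0.trans h2)
    calc Cardinal.sum (fun a => (2 ^ κ : Cardinal.{u}) ^ #(β a))
        ≤ Cardinal.sum fun _ : Shrink.{u} t ⊕ PUnit.{u + 1} => (2 ^ κ : Cardinal.{u}) := by
          refine Cardinal.sum_le_sum _ _ fun a => ?_
          rw [← Cardinal.power_mul]
          refine Cardinal.power_le_power_left two_ne_zero ?_
          refine (mul_le_mul' le_rfl ?_).trans (Cardinal.mul_eq_left hκ hκ aleph0_ne_zero).le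
          rcases a with a | a <;> simp [β]
      _ ≤ 2 ^ κ := by
          rw [Cardinal.sum_const']
          exact Cardinal.mul_le_of_le h2 hα le_rfl
  let ev : WType β → ZFSet.{u} := fun w => w.elim ZFSet.{u} fun p =>
    match p with
    | ⟨Sum.inl x, _⟩ => ((equivShrink t).symm x).1
    | ⟨Sum.inr _, g⟩ => ZFSet.range fun n : ULift.{u} ℕ => g n
  have hD : ∀ z, z ∈ ZFSet.range ev ↔ ∃ w, ev w = z := fun z => ZFSet.mem_range
  have htD : t ⊆ ZFSet.range ev := fun x hx => (hD x).2
    ⟨⟨Sum.inl (equivShrink t ⟨x, hx⟩), PEmpty.elim⟩, by simp [ev, WType.elim]⟩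
  refine ⟨ZFSet.range ev, htD, ?_, ?_, ?_⟩
  · intro y hy z hz
    obtain ⟨⟨a, g⟩, rfl⟩ := (hD y).1 hy
    rcases a with x | x
    · exact htD (ht _ ((equivShrink t).symm x).2 hz)
    · obtain ⟨n, rfl⟩ := ZFSet.mem_range.1 (show z ∈ ZFSet.range fun n => ev (g n) from hz)
      exact (hD _).2 ⟨_, rfl⟩
  · have h := lift_card_range_le (f := ev)
    rw [Cardinal.lift_id, Cardinal.lift_id] at h
    exact h.trans hW
  · intro y hy hyc
    rcases Set.eq_empty_or_nonempty (y : Set ZFSet.{u}) with h | h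
    -- The empty set is not the range of a sequence, so it has to come from t.
    · have : y = ∅ := (ZFSet.eq_empty y).2 fun x hx =>
        Set.eq_empty_iff_forall_notMem.1 h x hx
      rw [this]
      exact htD hte
    · obtain ⟨e, he⟩ := hyc.exists_eq_range h
      have hw : ∀ n, ∃ w, ev w = e n := fun n => (hD _).1 (hy (by
        change e n ∈ (y : Set ZFSet.{u})
        rw [he]
        exact ⟨n, rfl⟩))
      choose w hw using hw
      refine (hD _).2 ⟨⟨Sum.inr PUnit.unit, fun n : ULift.{u} ℕ => w n.down⟩, ?_⟩
      refine SetLike.coe_injective ?_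
      rw [he]
      change ((ZFSet.range fun n : ULift.{u} ℕ => ev (w n.down) : ZFSet.{u}) : Set ZFSet.{u}) = _
      rw [ZFSet.coe_range]
      ext x
      constructor
      · rintro ⟨n, rfl⟩
        exact ⟨n.down, (hw _).symm⟩
      · rintro ⟨n, rfl⟩
        exact ⟨⟨n⟩, hw _⟩

theorem isTransitive_toZFSet (o : Ordinal.{u}) : o.toZFSet.IsTransitive :=
  (isOrdinal_toZFSet o).isTransitive

theorem isOmega_toZFSet {X : Set ZFSet.{u}} (hX : IsCountablyClosed X)
    (h : (Ordinal.omega0.{u}).toZFSet ∈ X) : IsOmega (⟨_, h⟩ : X) := by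
  have hmem : ∀ n : ℕ, ((n : Ordinal.{u}).toZFSet) ∈ (Ordinal.omega0.{u}).toZFSet := fun n =>
    toZFSet_mem_toZFSet_iff.2 (Ordinal.natCast_lt_omega0 n)
  have hnat : ∀ a ∈ (Ordinal.omega0.{u}).toZFSet, ∃ n : ℕ, a = (n : Ordinal.{u}).toZFSet := by
    intro a ha
    obtain ⟨b, hb, rfl⟩ := mem_toZFSet_iff.1 ha
    obtain ⟨n, rfl⟩ := Ordinal.lt_omega0.1 hb
    exact ⟨n, rfl⟩
  have hsucc : ∀ n : ℕ, ((n + 1 : ℕ) : Ordinal.{u}).toZFSet =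
      insert (n : Ordinal.{u}).toZFSet (n : Ordinal.{u}).toZFSet := fun n => by
    rw [Nat.cast_succ, toZFSet_add_one]
  have hmX : ∀ n : ℕ, (n : Ordinal.{u}).toZFSet ∈ X := fun n => hX.mem_of_mem _ h _ (hmem n)
  refine ⟨⟨⟨_, hmX 0⟩, hmem 0, ?_⟩, fun a ha => ?_, fun a ha => ?_⟩
  · rw [hX.isEmptySet_iff]
    simp
  · obtain ⟨n, hn⟩ := hnat a ha
    refine ⟨⟨_, hmX (n + 1)⟩, hmem _, ?_⟩
    rw [hX.isSucc_iff, hn]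
    exact hsucc n
  · obtain ⟨n, hn⟩ := hnat a ha
    rw [hX.isEmptySet_iff]
    cases n with
    | zero => exact Or.inl (by rw [hn]; simp)
    | succ n =>
      refine Or.inr ⟨⟨_, hmX n⟩, hmem n, ?_, ?_⟩
      · rw [hn, hsucc]
        exact ZFSet.mem_insert _ _
      · rw [hX.isSucc_iff, hn]
        exact hsucc n

theorem exists_mem_omega_one_of_countable (A : Set ZFSet.{u}) (hA : A.Countable)
    (h : A ⊆ (Ordinal.omega 1 : Ordinal.{u}).toZFSet) :
    ∃ a ∈ (Ordinal.omega 1 : Ordinal.{u}).toZFSet, A ⊆ (a : Set ZFSet.{u}) := by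
  have hr : ∀ x : A, ∃ o < (Ordinal.omega 1 : Ordinal.{u}), o.toZFSet = x := fun x =>
    mem_toZFSet_iff.1 (h x.2)
  choose o ho ho' using hr
  have := hA.to_subtype
  have : Small.{u} A := Countable.toSmall A
  -- Successors make the supremum a strict bound; it stays below ω₁ by regularity.
  let s : Shrink.{u} A → Ordinal.{u} := fun i => Order.succ (o ((equivShrink.{u} A).symm i))
  have hlim : Order.IsSuccLimit (Ordinal.omega 1 : Ordinal.{u}) := isSuccLimit_omega 1
  have hs : ⨆ i, s i < (Ordinal.omega 1 : Ordinal.{u}) := by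
    refine Ordinal.iSup_lt_of_lt_cof ?_ fun i => hlim.succ_lt (ho _)
    have h1 : (Ordinal.omega 1 : Ordinal.{u}).cof = ℵ₁ := by
      have := Cardinal.isRegular_aleph_one.{u}.cof_ord
      rwa [Cardinal.ord_aleph] at this
    rw [h1]
    have := (equivShrink.{u} A).symm.injective.countable
    exact (Cardinal.mk_le_aleph0 (α := Shrink.{u} A)).trans_lt aleph0_lt_aleph_one
  refine ⟨_, toZFSet_mem_toZFSet_iff.2 hs, fun x hx => ?_⟩
  have h2 : o ⟨x, hx⟩ < ⨆ i, s i := by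
    refine (Order.lt_succ (o ⟨x, hx⟩)).trans_le ?_
    have := Ordinal.le_iSup s (equivShrink.{u} A ⟨x, hx⟩)
    simpa [s] using this
  have h3 := toZFSet_mem_toZFSet_iff.2 h2
  rwa [ho'] at h3

/-! ### Closure properties of good models -/

/-- Cofinality in [M]^ℵ₀ concerns infinite sets only, so Y is first padded with a countably infinite
subset of M. -/
theorem exists_countable_cover {χ : Cardinal.{u}} {M : Set ZFSet.{u}} (hM : M ∈ goodModels χ)
    (Y : Set ZFSet.{u}) (hY : Y ⊆ M) (hYc : Y.Countable) :
    ∃ y ∈ M, Y ⊆ (y : Set ZFSet.{u}) ∧ (y : Set ZFSet.{u}) ⊆ M ∧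
      (y : Set ZFSet.{u}).Countable := by
  obtain ⟨Z, hZM, hZ⟩ := Cardinal.le_mk_iff_exists_subset.1
    ((Cardinal.aleph0_le_aleph 1).trans hM.2.1.ge)
  obtain ⟨_, ⟨⟨h1, h2⟩, y, hyM, rfl⟩, h3⟩ := hM.2.2 (Y ∪ Z) ⟨Set.union_subset hY hZM, by
    refine le_antisymm ?_ (hZ.ge.trans (Cardinal.mk_le_mk_of_subset Set.subset_union_right))
    rw [Cardinal.le_aleph0_iff_set_countable]
    exact hYc.union (Cardinal.le_aleph0_iff_set_countable.1 hZ.le)⟩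
  exact ⟨y, hyM, Set.subset_union_left.trans h3, h1, Cardinal.le_aleph0_iff_set_countable.1 h2.le⟩

namespace IsElementarySubmodel

variable {M X : Set ZFSet.{u}}

theorem pair_mem (hM : IsElementarySubmodel M X) (hX : IsCountablyClosed X) {a b : ZFSet.{u}}
    (ha : a ∈ M) (hb : b ∈ M) : pair a b ∈ M := by
  obtain ⟨p, hp, h⟩ := hM.exists_mem (α := Fin 2)
    (R := fun v p => (p : ZFSet.{u}) = pair (v 0) (v 1))
    (hX.isDefinable_eq_pair _ _ _) ![⟨a, hM.subset ha⟩, ⟨b, hM.subset hb⟩]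
    (by intro i; fin_cases i <;> assumption)
    ⟨⟨_, hX.pair_mem (hM.subset ha) (hM.subset hb)⟩, rfl⟩
  rwa [h] at hp

theorem mem_of_pair_mem (hM : IsElementarySubmodel M X) (hX : IsCountablyClosed X) {a b : ZFSet.{u}}
    (h : pair a b ∈ M) : a ∈ M ∧ b ∈ M := by
  have hmem : ∀ c ∈ ({a, b} : ZFSet.{u}), c ∈ X := fun c hc =>
    hX.mem_of_mem _ (hX.mem_of_mem _ (hM.subset h) {a, b} (by simp [pair])) c hc
  have hdef : IsDefinable fun v : Fin 1 ⊕ Fin 2 → X =>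
    (v (.inl 0) : ZFSet.{u}) = pair (v (.inr 0)) (v (.inr 1)) := hX.isDefinable_eq_pair _ _ _
  obtain ⟨i, hi, hi'⟩ := hM.exists_forall_mem (α := Fin 1) (β := Fin 2)
    (R := fun v i => (v 0 : ZFSet.{u}) = pair (i 0) (i 1)) hdef
    ![⟨_, hM.subset h⟩] (by intro i; fin_cases i; exact h)
    ⟨![⟨a, hmem a (by simp)⟩, ⟨b, hmem b (by simp)⟩], rfl⟩
  obtain ⟨h1, h2⟩ := pair_injective hi'
  rw [h1, h2]
  exact ⟨hi 0, hi 1⟩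

theorem subset_of_isOmega (hM : IsElementarySubmodel M X) (hX : IsCountablyClosed X) {o : X}
    (ho : IsOmega o) : ((o : ZFSet.{u}) : Set ZFSet.{u}) ⊆ M := by
  have h : ∀ n : ℕ, (fun x : ZFSet.{u} => insert x x)^[n] ∅ ∈ M := by
    intro n
    induction n with
    | zero =>
      obtain ⟨z, -, hz⟩ := ho.1
      obtain ⟨x, hx, h⟩ := hM.exists_mem (α := Empty) (R := fun _ x => IsEmptySet x)
        (isDefinable_isEmptySet _) Empty.elim (fun a => a.elim) ⟨z, hz⟩
      rwa [hX.isEmptySet_iff.1 h] at hx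
    | succ n ih =>
      obtain ⟨b, -, hb⟩ := ho.2.1 ⟨_, hM.subset ih⟩ (ho.iterate_mem hX n)
      obtain ⟨x, hx, h⟩ := hM.exists_mem (α := Unit) (R := fun v x => IsSucc x (v ()))
        (isDefinable_isSucc _ _) (fun _ => ⟨_, hM.subset ih⟩) (fun _ => ih) ⟨b, hb⟩
      rw [Function.iterate_succ_apply']
      rwa [hX.isSucc_iff.1 h] at hx
  intro a ha
  obtain ⟨n, rfl⟩ := ho.eq_iterate hX a ha
  exact h n

/-- M contains an enumeration g of y and every natural number, and each element of y is the unique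
g-value at some natural number. -/
theorem subset_of_enumerates (hM : IsElementarySubmodel M X) (hX : IsCountablyClosed X) {o y : X}
    (ho : IsOmega o) (hoM : (o : ZFSet.{u}) ∈ M) (hyM : (y : ZFSet.{u}) ∈ M)
    (h : Enumerates o y) : ((y : ZFSet.{u}) : Set ZFSet.{u}) ⊆ M := by
  obtain ⟨g, hg, h1, h2⟩ := hM.exists_mem (α := Fin 2) (R := fun v g => IsEnumeration g (v 0) (v 1))
    (hX.isDefinable_isEnumeration _ _ _) ![o, y]
    (by intro i; fin_cases i <;> assumption) h
  intro x hx
  obtain ⟨a, ha, hax⟩ := h1 ⟨x, hX.mem_of_mem _ y.2 _ hx⟩ hx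
  obtain ⟨x', hx', hax'⟩ := hM.exists_mem (α := Fin 2)
    (R := fun v x => pair (v 0) x ∈ (v 1 : ZFSet.{u}))
    (hX.isDefinable_pair_mem _ _ _) ![a, g]
    (by
      intro i
      fin_cases i
      · exact hM.subset_of_isOmega hX ho ha
      · exact hg) ⟨_, hax⟩
  have h3 := h2 a _ _ hax hax'
  rwa [← h3] at hx'

theorem inter_mem (hM : IsElementarySubmodel M X) (hX : IsCountablyClosed X) {y D : ZFSet.{u}}
    (hy : y ∈ M) (hyc : (y : Set ZFSet.{u}).Countable) (hD : D ∈ M) : y ∩ D ∈ M := by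
  have hmem : y ∩ D ∈ X := hX.mem_of_countable _
    (fun x hx => hX.mem_of_mem _ (hM.subset hy) _ (ZFSet.mem_inter.1 hx).1)
    (hyc.mono fun x hx => (ZFSet.mem_inter.1 hx).1)
  obtain ⟨z, hz, h⟩ := hM.exists_mem (α := Fin 2)
    (R := fun v z => ∀ x : X, (x : ZFSet.{u}) ∈ (z : ZFSet.{u}) ↔
      (x : ZFSet.{u}) ∈ (v 0 : ZFSet.{u}) ∧ (x : ZFSet.{u}) ∈ (v 1 : ZFSet.{u}))
    (.all (.iff (.mem _ _) (.and (.mem _ _) (.mem _ _))))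
    ![⟨y, hM.subset hy⟩, ⟨D, hM.subset hD⟩]
    (by intro i; fin_cases i <;> assumption) ⟨⟨_, hmem⟩, fun x => ZFSet.mem_inter⟩
  have h1 : (z : ZFSet.{u}) = y ∩ D :=
    (hX.ext_iff hmem).2 fun x => (h x).trans ZFSet.mem_inter.symm
  rwa [h1] at hz

end IsElementarySubmodel

/-! ### From one model to reflection -/

/-- N = D ∩ M is a reflecting set for f. Elementarity does not say that w is ω₁, so the clauses on w
have to yield w ⊆ M and |w| ≥ ℵ₁. -/
theorem not_isCounterexample {χ : Cardinal.{u}} (hχ : χ.IsRegular) (h1 : ℵ₁ < χ) {P : SetPoset.{u}}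
    {M : Set ZFSet.{u}} (hM : M ∈ goodModels χ)
    (hσ : P.LeSigma ((P.carrier : Set ZFSet.{u}) ∩ M)) {c r D f w o : H χ}
    (hc : (c : ZFSet.{u}) = P.carrier) (hr : (r : ZFSet.{u}) = P.rel)
    (hDM : (D : ZFSet.{u}) ∈ M) (hfM : (f : ZFSet.{u}) ∈ M) (hwM : (w : ZFSet.{u}) ∈ M)
    (hoM : (o : ZFSet.{u}) ∈ M) : ¬IsCounterexample c r D f w o := by
  rintro ⟨ho, htri, hwc, hwb, hwD, hcD, hDc, hf, hno⟩
  have h0 : ℵ₀ < χ := aleph0_lt_aleph_one.trans h1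
  have hX := isCountablyClosed_H hχ h0
  have hMe := hM.1
  rw [hX.internalSubset_iff] at hwD hcD
  have hcount : ∀ y : H χ, Enumerates o y ↔ ((y : ZFSet.{u}) : Set ZFSet.{u}).Countable :=
    fun y => ho.enumerates_iff hχ h0
  have hDc' : ∀ y : ZFSet.{u}, y ⊆ D → (y : Set ZFSet.{u}).Countable → y ∈ (D : ZFSet.{u}) := by
    intro y hy hyc
    have hyH := mem_H_of_countable hχ h0 hyc fun x hx => mem_H_of_mem D.2 (hy hx)
    exact hDc ⟨y, hyH⟩ ((hcount _).2 hyc) (hX.internalSubset_iff.2 hy)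
  have hwb' : ∀ y : ZFSet.{u}, y ∈ H χ → (y : Set ZFSet.{u}).Countable →
      ∃ a ∈ (w : ZFSet.{u}), ∀ b ∈ y, b ∈ (w : ZFSet.{u}) → b ∈ a := by
    intro y hy hyc
    obtain ⟨a, ha, h⟩ := hwb ⟨y, hy⟩ ((hcount _).2 hyc)
    exact ⟨a, ha, fun b hb hb' => h ⟨b, mem_H_of_mem hy hb⟩ hb hb'⟩
  -- Otherwise some countable y ∈ M covers w ∩ M, and M contains an a ∈ w above all of y ∩ w; then a
  -- ∈ y, so a ∈ a.
  have hwMc : ¬(((w : ZFSet.{u}) : Set ZFSet.{u}) ∩ M).Countable := by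
    intro hcon
    obtain ⟨y, hyM, hy, -, hyc⟩ := exists_countable_cover hM _ Set.inter_subset_right hcon
    obtain ⟨a', ha', hya'⟩ := hwb' y (hMe.subset hyM) hyc
    obtain ⟨a, haM, ha, hya⟩ := hMe.exists_mem (α := Fin 2)
      (R := fun v a => (a : ZFSet.{u}) ∈ (v 1 : ZFSet.{u}) ∧
        ∀ b : H χ, (b : ZFSet.{u}) ∈ (v 0 : ZFSet.{u}) → (b : ZFSet.{u}) ∈ (v 1 : ZFSet.{u}) →
          (b : ZFSet.{u}) ∈ (a : ZFSet.{u}))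
      (.and (.mem _ _) (.all (.imp (.mem _ _) (.imp (.mem _ _) (.mem _ _)))))
      ![⟨y, hMe.subset hyM⟩, w] (by intro i; fin_cases i <;> assumption)
      ⟨⟨a', mem_H_of_mem w.2 ha'⟩, ha', fun b hb hb' => hya' b hb hb'⟩
    exact ZFSet.mem_irrefl _ (hya a (hy ⟨ha, haM⟩) ha)
  have hwc' : ∀ a ∈ (w : ZFSet.{u}), (a : Set ZFSet.{u}).Countable := fun a ha =>
    (hcount ⟨a, mem_H_of_mem w.2 ha⟩).1 (hwc _ ha)
  -- If b ∈ w \ M, every a ∈ w ∩ M is a countable element of M, so a ⊆ M and b ∉ a; by trichotomy a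
  -- ∈ b. Thus w ∩ M is included in the countable set b, a contradiction.
  have hwsub : ((w : ZFSet.{u}) : Set ZFSet.{u}) ⊆ M := by
    intro b hb
    by_contra hbM
    refine hwMc ((hwc' b hb).mono ?_)
    rintro a ⟨ha, haM⟩
    have haH := mem_H_of_mem w.2 ha
    rcases htri ⟨a, haH⟩ ⟨b, mem_H_of_mem w.2 hb⟩ ha hb with h | h | h
    · exact h
    · exact absurd haM (by rwa [Subtype.mk.inj h])
    · exact absurd (hMe.subset_of_enumerates hX ho hoM (y := ⟨a, haH⟩) haM (hwc _ ha) h) hbM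
  have hwc1 : ℵ₁ ≤ #((w : ZFSet.{u}) : Set ZFSet.{u}) := by
    rw [← succ_aleph0, Order.succ_le_iff, ← not_le, Cardinal.le_aleph0_iff_set_countable]
    exact fun h => hwMc (h.mono Set.inter_subset_left)
  obtain ⟨N, hN⟩ := exists_coe_eq_of_subset (((D : ZFSet.{u}) : Set ZFSet.{u}) ∩ M) D
    Set.inter_subset_left
  have hmemN : ∀ x, x ∈ N ↔ x ∈ (D : ZFSet.{u}) ∧ x ∈ M := fun x => by
    change x ∈ (N : Set ZFSet.{u}) ↔ _
    rw [hN]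
    rfl
  have hND : N ⊆ D := fun x hx => ((hmemN x).1 hx).1
  have hNH : N ∈ H χ := mem_H_of_subset D.2 hND
  refine hno ⟨N, hNH⟩ ⟨hX.internalSubset_iff.2 hND, ?_, ?_, ?_, ?_, ?_, ?_⟩
  · rw [enumerates_iff hχ h0]
    refine (Cardinal.mk_le_mk_of_subset ?_).trans (hM.2.1.le.trans hwc1)
    exact fun x hx => ((hmemN x).1 hx).2
  · exact hX.internalSubset_iff.2 fun x hx => (hmemN x).2 ⟨hwD hx, hwsub hx⟩
  · intro a b ha hb
    obtain ⟨haD, haM⟩ := (hmemN _).1 ha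
    obtain ⟨hbD, hbM⟩ := (hmemN _).1 hb
    exact (hmemN _).2 ⟨pair_mem_of_countable_closed (D := ((D : ZFSet.{u}) : Set ZFSet.{u}))
      (fun y hy hyc => hDc' y hy hyc) haD hbD, hMe.pair_mem hX haM hbM⟩
  · intro a ha
    obtain ⟨haD, haM⟩ := (hmemN _).1 ha
    obtain ⟨b, hbM, hbD, hab⟩ := hMe.exists_mem (α := Fin 3)
      (R := fun v b => (b : ZFSet.{u}) ∈ (v 0 : ZFSet.{u}) ∧ pair (v 1) b ∈ (v 2 : ZFSet.{u}))
      (.and (.mem _ _) (hX.isDefinable_pair_mem _ _ _)) ![D, a, f]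
      (by intro i; fin_cases i <;> assumption) (hf a haD)
    exact ⟨b, (hmemN _).2 ⟨hbD, hbM⟩, hab⟩
  · intro Y hYN hYc
    rw [hX.internalSubset_iff] at hYN
    obtain ⟨y, hyM, hYy, hyM', hyc⟩ := exists_countable_cover hM _
      (fun x hx => ((hmemN x).1 (hYN hx)).2) ((hcount Y).1 hYc)
    -- The countable cover y ∈ M may leave D; its trace y ∩ D is in M by definability and in D by
    -- countable closure.
    have hyDM := hMe.inter_mem hX hyM hyc hDM
    have hyDc : ((y ∩ D : ZFSet.{u}) : Set ZFSet.{u}).Countable :=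
      hyc.mono fun x hx => (ZFSet.mem_inter.1 hx).1
    refine ⟨⟨y ∩ D, hMe.subset hyDM⟩, (hmemN _).2 ⟨hDc' _ ?_ hyDc, hyDM⟩, ?_, ?_, (hcount _).2 hyDc⟩
    · exact fun x hx => (ZFSet.mem_inter.1 hx).2
    · exact hX.internalSubset_iff.2 fun x hx => ZFSet.mem_inter.2 ⟨hYy hx, hND (hYN hx)⟩
    · exact hX.internalSubset_iff.2 fun x hx =>
        (hmemN x).2 ⟨(ZFSet.mem_inter.1 hx).2, hyM' (ZFSet.mem_inter.1 hx).1⟩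
  · rw [internalLeSigma_iff hχ h0 ho hc hr]
    have hcD' : (P.carrier : Set ZFSet.{u}) ⊆ ((D : ZFSet.{u}) : Set ZFSet.{u}) := fun x hx =>
      hcD (by rwa [hc])
    have hcN : (P.carrier : Set ZFSet.{u}) ∩ (N : Set ZFSet.{u}) =
        (P.carrier : Set ZFSet.{u}) ∩ M := by
      rw [hN, ← Set.inter_assoc, Set.inter_eq_left.2 hcD']
    change P.LeSigma ((P.carrier : Set ZFSet.{u}) ∩ (N : Set ZFSet.{u}))
    rwa [hcN]

/-- With the true ω and ω₁ every clause is absolute: countable sets, enumerations and candidates N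
in H_χ mean there what they mean outside. -/
theorem isCounterexample_of_not_hasReflection {χ : Cardinal.{u}} (hχ : χ.IsRegular) (h1 : ℵ₁ < χ)
    {P : SetPoset.{u}} {c r D f w o : H χ} (hc : (c : ZFSet.{u}) = P.carrier)
    (hr : (r : ZFSet.{u}) = P.rel) (ho : (o : ZFSet.{u}) = (Ordinal.omega0.{u}).toZFSet)
    (hw : (w : ZFSet.{u}) = (Ordinal.omega 1 : Ordinal.{u}).toZFSet)
    (hwD : (w : ZFSet.{u}) ⊆ D) (hcD : P.carrier ⊆ D)
    (hD : ∀ y : ZFSet.{u}, y ⊆ D → (y : Set ZFSet.{u}).Countable → y ∈ (D : ZFSet.{u}))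
    (F : ZFSet.{u} → ZFSet.{u}) (hF : ∀ a ∈ (D : ZFSet.{u}), F a ∈ (D : ZFSet.{u}))
    (hf : ∀ p, p ∈ (f : ZFSet.{u}) ↔ ∃ a ∈ (D : ZFSet.{u}), pair a (F a) = p)
    (hno : ¬∃ N ⊆ ((D : ZFSet.{u}) : Set ZFSet.{u}), #N ≤ ℵ₁ ∧
      ((w : ZFSet.{u}) : Set ZFSet.{u}) ⊆ N ∧ (∀ a ∈ N, ∀ b ∈ N, pair a b ∈ N) ∧
      (∀ a ∈ N, F a ∈ N) ∧ (∀ Y ⊆ N, Y.Countable → ∃ y ∈ N, Y ⊆ (y : Set ZFSet.{u}) ∧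
        (y : Set ZFSet.{u}) ⊆ N ∧ (y : Set ZFSet.{u}).Countable) ∧
      P.LeSigma ((P.carrier : Set ZFSet.{u}) ∩ N)) :
    IsCounterexample c r D f w o := by
  have h0 : ℵ₀ < χ := aleph0_lt_aleph_one.trans h1
  have hX := isCountablyClosed_H hχ h0
  have ho' : IsOmega o := by
    obtain ⟨o, hoH⟩ := o
    dsimp only at ho
    subst ho
    exact isOmega_toZFSet hX hoH
  have hcount : ∀ y : H χ, Enumerates o y ↔ ((y : ZFSet.{u}) : Set ZFSet.{u}).Countable :=
    fun y => ho'.enumerates_iff hχ h0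
  have hwcard : #((w : ZFSet.{u}) : Set ZFSet.{u}) = ℵ₁ := by
    rw [mk_coe, hw, card_toZFSet]
    simp
  refine ⟨ho', ?_, ?_, ?_, hX.internalSubset_iff.2 hwD,
    hX.internalSubset_iff.2 (by rwa [hc]), ?_, ?_, ?_⟩
  · intro a b ha hb
    rw [hw] at ha hb
    have hord := isOrdinal_toZFSet (Ordinal.omega 1 : Ordinal.{u})
    rcases (hord.mem ha).mem_trichotomous (hord.mem hb) with h | h | h
    · exact Or.inl h
    · exact Or.inr (Or.inl (Subtype.ext h))
    · exact Or.inr (Or.inr h)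
  · intro a ha
    rw [hcount, countable_coe_iff]
    rw [hw, mem_toZFSet_iff] at ha
    obtain ⟨i, hi, hia⟩ := ha
    rw [← hia, card_toZFSet, ← Cardinal.lt_aleph_one_iff, ← Cardinal.lt_ord, Cardinal.ord_aleph]
    exact hi
  · intro y hy
    rw [hcount] at hy
    obtain ⟨a, ha, hya⟩ := exists_mem_omega_one_of_countable
      ((y : ZFSet.{u}) ∩ ((w : ZFSet.{u}) : Set ZFSet.{u})) (hy.mono Set.inter_subset_left)
      (by rw [← hw]; exact Set.inter_subset_right)
    rw [← hw] at ha
    exact ⟨⟨a, mem_H_of_mem w.2 ha⟩, ha, fun b hb hb' => hya ⟨hb, hb'⟩⟩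
  · intro y hy hyD
    exact hD y (hX.internalSubset_iff.1 hyD) ((hcount y).1 hy)
  · intro a ha
    exact ⟨⟨F a, mem_H_of_mem D.2 (hF a ha)⟩, hF a ha, (hf _).2 ⟨a, ha, rfl⟩⟩
  · rintro N ⟨hND, hNw, hwN, hNp, hNf, hNcov, hNσ⟩
    rw [hX.internalSubset_iff] at hND hwN
    have hNH : ∀ a ∈ (N : ZFSet.{u}), a ∈ H χ := fun a ha => mem_H_of_mem N.2 ha
    refine hno ⟨(N : ZFSet.{u}), hND, ?_, hwN, ?_, ?_, ?_, ?_⟩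
    · rw [← hwcard]
      exact (enumerates_iff hχ h0).1 hNw
    · exact fun a ha b hb => hNp ⟨a, hNH a ha⟩ ⟨b, hNH b hb⟩ ha hb
    · intro a ha
      obtain ⟨b, hb, hab⟩ := hNf ⟨a, hNH a ha⟩ ha
      obtain ⟨a', -, haa'⟩ := (hf _).1 hab
      obtain ⟨h2, h3⟩ := pair_injective haa'
      rw [h2] at h3
      change F a ∈ (N : ZFSet.{u})
      rwa [h3]
    · intro Y hYN hYc
      have := hYc.to_subtype
      obtain ⟨Y, rfl⟩ := exists_coe_eq Y
      obtain ⟨y, hy, hYy, hyN, hyc⟩ := hNcov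
        ⟨Y, mem_H_of_countable hχ h0 hYc fun x hx => hNH x (hYN hx)⟩
        (hX.internalSubset_iff.2 hYN) ((hcount _).2 hYc)
      rw [hX.internalSubset_iff] at hYy hyN
      exact ⟨y, hy, hYy, hyN, (hcount _).1 hyc⟩
    · rwa [internalLeSigma_iff hχ h0 ho' hc hr] at hNσ

namespace SetPoset

variable {P : SetPoset.{u}}

/-- The bound 2^κ < χ is needed so that D and the graph of a bad function on it are elements of H_χ.
-/
theorem exists_hasReflection_of_nonempty_models {χ : Cardinal.{u}} (hχ : χ.IsRegular)
    (hκ : 2 ^ P.kappa < χ) (hne : (P.models χ).Nonempty) :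
    ∃ D W : Set ZFSet.{u}, (P.carrier : Set ZFSet.{u}) ⊆ D ∧ #W = ℵ₁ ∧ P.HasReflection D W := by
  have hκχ : P.kappa < χ := (Cardinal.cantor _).trans hκ
  have h1 : ℵ₁ < χ := aleph_one_lt_of_kappa_lt hκχ
  have h0 : ℵ₀ < χ := aleph0_lt_aleph_one.trans h1
  have hX := isCountablyClosed_H hχ h0
  have hκ1 : ℵ₁ ≤ P.kappa := le_max_right _ _
  have hκ0 : ℵ₀ ≤ P.kappa := (Cardinal.aleph0_le_aleph 1).trans hκ1
  obtain ⟨M, hM, hcode, hσ⟩ := hne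
  obtain ⟨hcM, hrM⟩ := hM.1.mem_of_pair_mem hX hcode
  let w : ZFSet.{u} := (Ordinal.omega 1 : Ordinal.{u}).toZFSet
  have how : (Ordinal.omega0.{u}).toZFSet ⊆ w :=
    toZFSet_subset_toZFSet_iff.2 (Ordinal.omega0_le_omega 1)
  obtain ⟨D, htD, hDt, hDcard, hDc⟩ := exists_countably_closed_set hκ0 (trcl P.carrier ∪ w)
    ((isTransitive_trcl _).union (isTransitive_toZFSet _))
    (card_union_le.trans (Cardinal.add_le_of_le hκ0 (le_max_left _ _)
      ((card_toZFSet _).trans_le (by simpa using hκ1))))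
    (ZFSet.mem_union.2 (Or.inr (by
      have := toZFSet_mem_toZFSet_iff.2 (Ordinal.omega_pos 1)
      rwa [toZFSet_zero] at this)))
  have hcD : P.carrier ⊆ D := fun x hx =>
    htD (ZFSet.mem_union.2 (Or.inl (subset_trcl _ hx)))
  have hwD : w ⊆ D := fun x hx => htD (ZFSet.mem_union.2 (Or.inr hx))
  have hDH : ∀ x, x ⊆ D → x ∈ H χ := fun x hx =>
    mem_H_of_subset_isTransitive hx hDt (hDcard.trans_lt hκ)
  refine ⟨D, w, hcD, ?_, fun F hF => ?_⟩
  · rw [mk_coe, card_toZFSet]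
    simp
  by_contra hno
  -- D is closed under pairs, so the graph is a subset of D.
  obtain ⟨f, hf⟩ := exists_coe_eq_of_subset ((fun a => pair a (F a)) '' (D : Set ZFSet.{u})) D (by
    rintro _ ⟨a, ha, rfl⟩
    exact pair_mem_of_countable_closed (D := (D : Set ZFSet.{u})) (fun y hy hyc => hDc y hy hyc)
      ha (hF a ha))
  have hfm : ∀ p, p ∈ f ↔ ∃ a ∈ D, pair a (F a) = p := fun p => by
    change p ∈ (f : Set ZFSet.{u}) ↔ _
    rw [hf]
    rfl
  have hfD : f ⊆ D := fun p hp => by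
    obtain ⟨a, ha, rfl⟩ := (hfm p).1 hp
    exact pair_mem_of_countable_closed (D := (D : Set ZFSet.{u})) (fun y hy hyc => hDc y hy hyc)
      ha (hF a ha)
  let c' : H χ := ⟨P.carrier, hM.1.subset hcM⟩
  let r' : H χ := ⟨P.rel, hM.1.subset hrM⟩
  -- Only the carrier and the relation are known to lie in M; D, f, ω₁ and ω are quantified, to be
  -- replaced by witnesses from M.
  have hex : ∃ i : Fin 4 → H χ, IsCounterexample c' r' (i 0) (i 1) (i 2) (i 3) :=
    ⟨![⟨D, hDH D fun _ h => h⟩, ⟨f, hDH f hfD⟩, ⟨w, hDH w hwD⟩, ⟨_, hDH _ fun x hx => hwD (how hx)⟩],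
      isCounterexample_of_not_hasReflection hχ h1 rfl rfl rfl rfl hwD hcD hDc F hF hfm hno⟩
  have hdef : IsDefinable fun v : Fin 2 ⊕ Fin 4 → H χ =>
      IsCounterexample (v (.inl 0)) (v (.inl 1)) (v (.inr 0)) (v (.inr 1)) (v (.inr 2))
        (v (.inr 3)) := hX.isDefinable_isCounterexample _ _ _ _ _ _
  obtain ⟨i, hi, hbad⟩ := hM.1.exists_forall_mem (α := Fin 2) (β := Fin 4)
    (R := fun v i => IsCounterexample (v 0) (v 1) (i 0) (i 1) (i 2) (i 3)) hdef ![c', r']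
    (by intro i; fin_cases i <;> assumption) hex
  exact not_isCounterexample hχ h1 hM hσ rfl rfl (hi 0) (hi 1) (hi 2) (hi 3) hbad

end SetPoset

/-! ### The remaining implications -/

theorem isClub_superset {X Y : Set ZFSet.{u}} (hX : ℵ₁ ≤ #X) (hY : Y ⊆ X) (hc : #Y ≤ ℵ₁) :
    IsClub X {N ∈ subsetsOfCard X ℵ₁ | Y ⊆ N} := by
  simpa using isClub_closed hX hY hc (ι := Empty) (fun i => i.elim) (fun i => i.elim)

namespace SetPoset

variable {P : SetPoset.{u}}

/-- `SEP` does not ask for P ∈ M; cofinality above a set containing `P.code` provides it. -/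
theorem exists_nonempty_models_of_sep (h : P.SEP) :
    ∃ χ : Cardinal.{u}, χ.IsRegular ∧ 2 ^ P.kappa < χ ∧ (P.models χ).Nonempty := by
  obtain ⟨χ₀, hχ₀⟩ := h
  have h0 : ℵ₀ ≤ max χ₀ (2 ^ P.kappa) :=
    (Cardinal.aleph0_le_aleph 1).trans ((le_max_right _ _).trans
      ((Cardinal.cantor P.kappa).le.trans (le_max_right _ _)))
  have hχ := Cardinal.isRegular_succ h0
  have h2 : 2 ^ P.kappa < Order.succ (max χ₀ (2 ^ P.kappa)) :=
    (le_max_right _ _).trans_lt (Order.lt_succ _)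
  have hκ := (Cardinal.cantor P.kappa).trans h2
  obtain ⟨X, hX, hcX⟩ := exists_subsetsOfCard (aleph_one_le_mk_H (aleph_one_lt_of_kappa_lt hκ))
    (Y := {P.code}) (by simpa using code_mem_H hχ hκ) (by
      rw [Cardinal.mk_singleton]
      exact Cardinal.one_le_aleph0.trans (Cardinal.aleph0_le_aleph 1))
  obtain ⟨M, ⟨hM, hσ⟩, hXM⟩ := hχ₀ _ hχ ((le_max_left _ _).trans (Order.le_succ _)) X hX
  exact ⟨_, hχ, h2, M, hM, hXM (hcX rfl), hσ⟩

/-- Stationarity meets the club of sets closed under an external f, so no elementarity argument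
about f, and hence no bound 2^κ, is needed. -/
theorem exists_hasReflection_of_isStationary {χ : Cardinal.{u}} (hχ : χ.IsRegular)
    (hκ : P.kappa < χ) (hS : IsStationary (H χ) (P.models χ)) :
    ∃ D W : Set ZFSet.{u}, (P.carrier : Set ZFSet.{u}) ⊆ D ∧ #W = ℵ₁ ∧ P.HasReflection D W := by
  have h1 : ℵ₁ < χ := aleph_one_lt_of_kappa_lt hκ
  have hX := isCountablyClosed_H hχ (aleph0_lt_aleph_one.trans h1)
  have hH := aleph_one_le_mk_H h1
  obtain ⟨W, hWH, hW⟩ := Cardinal.le_mk_iff_exists_subset.1 hH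
  refine ⟨H χ, W, fun x hx => mem_H_of_mem (carrier_mem_H hκ) hx, hW, fun f hf => ?_⟩
  obtain ⟨N, ⟨hN, -, hσ⟩, hNH, hWN, hNf⟩ := hS.2 _ (isClub_closed hH hWH hW.le
    (ι := Unit) (fun _ a _ => f a) (fun _ a ha _ _ => hf a ha))
  exact ⟨N, hNH.1, hNH.2.le, hWN, fun a ha b hb => hN.1.pair_mem hX ha hb,
    fun a ha => hNf () a ha a ha, exists_countable_cover hN, hσ⟩

theorem sep_of_forall_isStationary
    (h : ∀ χ : Cardinal.{u}, χ.IsRegular → P.kappa < χ → IsStationary (H χ) (P.models χ)) :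
    P.SEP := by
  refine ⟨Order.succ P.kappa, fun χ hχ hκ X hX => ?_⟩
  rw [Order.succ_le_iff] at hκ
  obtain ⟨M, hM, -, hXM⟩ := (h χ hχ hκ).2 _ (isClub_superset
    (aleph_one_le_mk_H (aleph_one_lt_of_kappa_lt hκ)) hX.1 hX.2.le)
  exact ⟨M, ⟨hM.1, hM.2.2⟩, hXM⟩

theorem nonempty_models_of_isStationary {χ : Cardinal.{u}} (hκ : P.kappa < χ)
    (h : IsStationary (H χ) (P.models χ)) : (P.models χ).Nonempty :=
  (h.2 _ (isClub_superset (aleph_one_le_mk_H (aleph_one_lt_of_kappa_lt hκ))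
    (Set.empty_subset _) (by simp))).mono Set.inter_subset_left

theorem exists_isRegular_gt (κ : Cardinal.{u}) : ∃ χ : Cardinal.{u}, χ.IsRegular ∧ κ < χ :=
  ⟨_, Cardinal.isRegular_succ (le_max_right κ ℵ₀), (le_max_left _ _).trans_lt (Order.lt_succ _)⟩

end SetPoset

end SepPrinciple

theorem theorem8p1 (P : SepPrinciple.SetPoset.{u}) :
    List.TFAE [
      P.SEP,
      ∃ χ : Cardinal.{u}, χ.IsRegular ∧ P.kappa < χ ∧
        SepPrinciple.IsStationary (SepPrinciple.H χ) (P.models χ),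
      ∀ χ : Cardinal.{u}, χ.IsRegular → P.kappa < χ →
        SepPrinciple.IsStationary (SepPrinciple.H χ) (P.models χ),
      ∃ χ : Cardinal.{u}, χ.IsRegular ∧ 2 ^ P.kappa < χ ∧ (P.models χ).Nonempty,
      ∀ χ : Cardinal.{u}, χ.IsRegular → 2 ^ P.kappa < χ → (P.models χ).Nonempty] := by
  tfae_have 1 → 4 := SepPrinciple.SetPoset.exists_nonempty_models_of_sep
  -- Reflection does not mention χ, so it transfers the information from χ to an arbitrary χ'.
  tfae_have 4 → 3 := by
    rintro ⟨χ, hχ, hκ, hne⟩ χ' hχ' hκ'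
    obtain ⟨D, W, hcD, hW, hR⟩ :=
      SepPrinciple.SetPoset.exists_hasReflection_of_nonempty_models hχ hκ hne
    exact hR.isStationary hcD hW hχ' hκ'
  tfae_have 2 → 3 := by
    rintro ⟨χ, hχ, hκ, hS⟩ χ' hχ' hκ'
    obtain ⟨D, W, hcD, hW, hR⟩ :=
      SepPrinciple.SetPoset.exists_hasReflection_of_isStationary hχ hκ hS
    exact hR.isStationary hcD hW hχ' hκ'
  tfae_have 3 → 1 := SepPrinciple.SetPoset.sep_of_forall_isStationary
  tfae_have 3 → 2 := fun h => by
    obtain ⟨χ, hχ, hκ⟩ := SepPrinciple.SetPoset.exists_isRegular_gt P.kappa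
    exact ⟨χ, hχ, hκ, h χ hχ hκ⟩
  tfae_have 3 → 5 := fun h χ hχ hκ =>
    SepPrinciple.SetPoset.nonempty_models_of_isStationary ((Cardinal.cantor _).trans hκ)
      (h χ hχ ((Cardinal.cantor _).trans hκ))
  tfae_have 5 → 4 := fun h => by
    obtain ⟨χ, hχ, hκ⟩ := SepPrinciple.SetPoset.exists_isRegular_gt (2 ^ P.kappa)
    exact ⟨χ, hχ, hκ, h χ hχ hκ⟩
  tfae_finish
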